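/- Let $N\ge 0$ be an integer, let $A,B$ be complex $N\times N$ matrices with $B=B^*$ ($A$ is arbitrary, possibly singular), and let $H_0$ be the bounded self-adjoint operator on $\ell^2(\mathbb Z,\mathbb C^N)$ given by $$(H_0\psi)_n=A^*\psi_{n-1}+B\psi_n+A\psi_{n+1},\qquad n\in\mathbb Z.$$ For $p\in\mathbb R$ put $h(p)=e^{-ip}A+e^{ip}A^*+B$. (a) There are real-analytic functions $\lambda_j$ (real-valued) and $W_j$ ($\mathbb C^N$-valued), $1\le j\le N$, on a neighbourhood of $[-\pi,\pi]$ such that, for every $p\in[-\pi,\pi]$, $W_1(p),\dots,W_N(p)$ is an orthonormal basis of $\mathbb C^N$ and $h(p)W_j(p)=\lambda_j(p)W_j(p)$ for all $j$; in particular $\lambda_1(p),\dots,\lambda_N(p)$ are the eigenvalues of $h(p)$ repeated according to multiplicity. (b) For every such choice of $(\lambda_j,W_j)_{1\le j\le N}$, put $\kappa(\lambda_j)=\{\lambda_j(p) : p\in[-\pi,\pi],\ \lambda_j'(p)=0\}$ and $\kappa(H_0)=\bigcup_{j=1}^N\kappa(\lambda_j)$. Then $\kappa(H_0)$ is finite;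 the spectrum of $H_0$ is purely absolutely continuous on $\mathbb R\setminus\kappa(H_0)$, that is, for every $\psi\in\ell^2(\mathbb Z,\mathbb C^N)$ the spectral measure $J\mapsto\langle\psi,E_{H_0}(J)\psi\rangle$ restricted to $\mathbb R\setminus\kappa(H_0)$ is absolutely continuous with respect to Lebesgue measure; and $$\sigma(H_0)=\bigcup_{j=1}^N\lambda_j([-\pi,\pi]),\qquad \sigma_p(H_0)\subset\kappa(H_0),\qquad \sigma_{sc}(H_0)=\emptyset,$$ where $\sigma_p(H_0)$ is the set of eigenvalues of $H_0$ and $\sigma_{sc}(H_0)$ is its singular continuous spectrum, i.e. the spectrum of the restriction of $H_0$ to the subspace of all vectors whose spectral measure has no atoms and is singular with respect to Lebesgue measure. -/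

import Mathlib

open MeasureTheory
open scoped InnerProductSpace CompactlySupported

namespace BlockJacobi

noncomputable section

section Spectral

variable {H : Type*} [NormedAddCommGroup H] [InnerProductSpace ℂ H] [CompleteSpace H]

/-- The positive linear functional `f ↦ ⟪ψ, f(T) ψ⟫` on compactly supported continuous functions,
where `f(T)` is given by the continuous functional calculus of the self-adjoint operator `T`. -/
def spectralFunctional (T : H →L[ℂ] H) (ψ : H) : C_c(ℝ, ℝ) →ₚ[ℝ] ℝ :=
  PositiveLinearMap.mk₀
    { toFun := fun f => (⟪ψ, cfc (fun x : ℝ => f x) T ψ⟫_ℂ).re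
      map_add' := fun f g => by
        have h : cfc (fun x : ℝ => (f + g) x) T =
            cfc (fun x : ℝ => f x) T + cfc (fun x : ℝ => g x) T :=
          cfc_add (a := T) (fun x : ℝ => f x) (fun x : ℝ => g x)
            f.continuous.continuousOn g.continuous.continuousOn
        rw [h]
        simp
      map_smul' := fun c f => by
        have h : cfc (fun x : ℝ => (c • f) x) T = c • cfc (fun x : ℝ => f x) T :=
          cfc_smul c (fun x : ℝ => f x) T f.continuous.continuousOn
        rw [h, smul_apply, ← Complex.coe_smul, inner_smul_right]
        simp }
    (fun f hf => by
      have h : 0 ≤ cfc (fun x : ℝ => f x) T := cfc_nonneg fun x _ => hf x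
      rw [ContinuousLinearMap.nonneg_iff_isPositive] at h
      exact (Complex.le_def.1 (h.inner_nonneg_right ψ)).1)

/-- The spectral measure of the bounded self-adjoint operator `T` at the vector `ψ`: the measure
`J ↦ ⟪ψ, E_T(J) ψ⟫`, that is the Riesz-Markov measure `μ` on `ℝ` with
`∫ f dμ = ⟪ψ, f(T) ψ⟫` for all compactly supported continuous `f`. -/
def spectralMeasure (T : H →L[ℂ] H) (ψ : H) : Measure ℝ :=
  RealRMK.rieszMeasure (spectralFunctional T ψ)

instance regular_spectralMeasure (T : H →L[ℂ] H) (ψ : H) : (spectralMeasure T ψ).Regular :=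
  RealRMK.regular_rieszMeasure _

theorem integral_spectralMeasure (T : H →L[ℂ] H) (ψ : H) (f : C_c(ℝ, ℝ)) :
    ∫ x, f x ∂(spectralMeasure T ψ) = (⟪ψ, cfc (fun x : ℝ => f x) T ψ⟫_ℂ).re :=
  RealRMK.integral_rieszMeasure _ f

/-- A measure on `ℝ` is singular continuous if it has no atoms and is singular with respect to
Lebesgue measure. -/
def IsSingularContinuous (μ : Measure ℝ) : Prop :=
  (∀ x : ℝ, μ {x} = 0) ∧ μ ⟂ₘ (volume : Measure ℝ)

theorem IsSingularContinuous.mono {μ ν : Measure ℝ} (hν : IsSingularContinuous ν) (h : μ ≪ ν) :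
    IsSingularContinuous μ :=
  ⟨fun x => h (hν.1 x), hν.2.mono_ac h Measure.AbsolutelyContinuous.rfl⟩

theorem spectralMeasure_zero (T : H →L[ℂ] H) : spectralMeasure T 0 = 0 := by
  refine Measure.ext_of_integral_eq_on_compactlySupported fun f => ?_
  rw [integral_spectralMeasure]
  simp

theorem spectralMeasure_smul (T : H →L[ℂ] H) (c : ℂ) (ψ : H) :
    spectralMeasure T (c • ψ) = (‖c‖₊ ^ 2) • spectralMeasure T ψ := by
  refine Measure.ext_of_integral_eq_on_compactlySupported fun f => ?_
  rw [integral_smul_nnreal_measure, integral_spectralMeasure, integral_spectralMeasure, map_smul,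
    inner_smul_left, inner_smul_right, ← mul_assoc, ← Complex.normSq_eq_conj_mul_self,
    Complex.normSq_eq_norm_sq, Complex.re_ofReal_mul]
  simp [NNReal.smul_def]

theorem isLocallyFiniteMeasure_add (μ ν : Measure ℝ) [IsLocallyFiniteMeasure μ]
    [IsLocallyFiniteMeasure ν] : IsLocallyFiniteMeasure (μ + ν) := by
  refine ⟨fun x => ?_⟩
  obtain ⟨s, hs, hμ⟩ := μ.finiteAt_nhds x
  obtain ⟨t, ht, hν⟩ := ν.finiteAt_nhds x
  refine ⟨s ∩ t, Filter.inter_mem hs ht, ?_⟩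
  rw [Measure.add_apply]
  exact ENNReal.add_lt_top.2 ⟨(measure_mono Set.inter_subset_left).trans_lt hμ,
    (measure_mono Set.inter_subset_right).trans_lt hν⟩

/-- The parallelogram law for spectral measures. -/
theorem spectralMeasure_add_add_sub (T : H →L[ℂ] H) (φ ψ : H) :
    spectralMeasure T (φ + ψ) + spectralMeasure T (φ - ψ) =
      (2 : NNReal) • (spectralMeasure T φ + spectralMeasure T ψ) := by
  have : IsLocallyFiniteMeasure (spectralMeasure T (φ + ψ) + spectralMeasure T (φ - ψ)) :=
    isLocallyFiniteMeasure_add _ _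
  have : IsLocallyFiniteMeasure (spectralMeasure T φ + spectralMeasure T ψ) :=
    isLocallyFiniteMeasure_add _ _
  refine Measure.ext_of_integral_eq_on_compactlySupported fun f => ?_
  have hi : ∀ χ : H, Integrable (fun x => f x) (spectralMeasure T χ) := fun χ =>
    f.continuous.integrable_of_hasCompactSupport f.hasCompactSupport
  rw [integral_smul_nnreal_measure, integral_add_measure (hi _) (hi _),
    integral_add_measure (hi _) (hi _)]
  simp only [integral_spectralMeasure, map_add, map_sub, inner_add_left, inner_add_right,
    inner_sub_left, inner_sub_right, Complex.add_re, Complex.sub_re, NNReal.smul_def, smul_eq_mul]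
  push_cast
  ring

/-- Multiplication by the spectral variable: `d⟪Tψ, E_T(x) Tψ⟫ = x² d⟪ψ, E_T(x) ψ⟫`. -/
theorem spectralMeasure_apply_ac (T : H →L[ℂ] H) (hT : IsSelfAdjoint T) (ψ : H) :
    spectralMeasure T (T ψ) ≪ spectralMeasure T ψ := by
  have hc : Continuous fun x : ℝ => ‖x‖₊ ^ 2 := by fun_prop
  have key : spectralMeasure T (T ψ) = (spectralMeasure T ψ).withDensity
      (fun x => ((‖x‖₊ ^ 2 : NNReal) : ENNReal)) := by
    have : IsLocallyFiniteMeasure ((spectralMeasure T ψ).withDensity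
      (fun x => ((‖x‖₊ ^ 2 : NNReal) : ENNReal))) := IsLocallyFiniteMeasure.withDensity_coe hc
    refine Measure.ext_of_integral_eq_on_compactlySupported fun f => ?_
    have hcont : Continuous fun x : ℝ => x ^ 2 * f x := by
      have hf := f.continuous
      fun_prop
    have hcs : HasCompactSupport fun x : ℝ => x ^ 2 * f x :=
      HasCompactSupport.mul_left (f := fun x : ℝ => x ^ 2) (f' := fun x => f x) f.hasCompactSupport
    let g : C_c(ℝ, ℝ) := ⟨⟨fun x => x ^ 2 * f x, hcont⟩, hcs⟩
    have hfg : ∫ x, f x ∂((spectralMeasure T ψ).withDensity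
        (fun x => ((‖x‖₊ ^ 2 : NNReal) : ENNReal))) = ∫ x, g x ∂(spectralMeasure T ψ) := by
      refine (integral_withDensity_eq_integral_smul (f := fun x : ℝ => ‖x‖₊ ^ 2) hc.measurable
        (fun x => f x)).trans (integral_congr_ae (Filter.Eventually.of_forall fun x => ?_))
      change ‖x‖ ^ 2 * f x = x ^ 2 * f x
      rw [Real.norm_eq_abs, sq_abs]
    rw [hfg]
    rw [integral_spectralMeasure, integral_spectralMeasure]
    have h1 : cfc (fun x : ℝ => g x) T = T * cfc (fun x : ℝ => f x) T * T := by
      have h2 : (fun x : ℝ => g x) = fun x => x * f x * x := by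
        funext x
        change x ^ 2 * f x = _
        ring
      have hf := f.continuous
      rw [h2, cfc_mul (fun x : ℝ => x * f x) (fun x => x) T (by fun_prop) (by fun_prop),
        cfc_mul (fun x : ℝ => x) (fun x => f x) T (by fun_prop) (by fun_prop), cfc_id' ℝ T]
    rw [h1]
    have h3 : ⟪T ψ, cfc (fun x : ℝ => f x) T (T ψ)⟫_ℂ =
        ⟪ψ, T (cfc (fun x : ℝ => f x) T (T ψ))⟫_ℂ :=
      (ContinuousLinearMap.isSelfAdjoint_iff_isSymmetric.1 hT) ψ _
    rw [h3]
    rfl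
  rw [key]
  exact withDensity_absolutelyContinuous _ _

/-- The singular continuous subspace `H_sc(T)` of a bounded self-adjoint operator: all vectors whose
spectral measure is singular continuous. -/
def singularContinuousSubspace (T : H →L[ℂ] H) : Submodule ℂ H where
  carrier := {ψ | IsSingularContinuous (spectralMeasure T ψ)}
  zero_mem' := by
    change IsSingularContinuous _
    rw [spectralMeasure_zero]
    exact ⟨fun x => by simp, Measure.MutuallySingular.zero_left⟩
  add_mem' := by
    intro φ ψ hφ hψ
    have h : IsSingularContinuous (spectralMeasure T φ + spectralMeasure T ψ) :=
      ⟨fun x => by simp [hφ.1 x, hψ.1 x], hφ.2.add_left hψ.2⟩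
    refine h.mono (Measure.AbsolutelyContinuous.trans (Measure.AbsolutelyContinuous.trans
      ?_ (spectralMeasure_add_add_sub T φ ψ).absolutelyContinuous)
      (Measure.smul_absolutelyContinuous))
    exact Measure.absolutelyContinuous_of_le (Measure.le_add_right le_rfl)
  smul_mem' := by
    intro c ψ hψ
    change IsSingularContinuous _
    rw [spectralMeasure_smul]
    exact IsSingularContinuous.mono hψ Measure.smul_absolutelyContinuous

theorem apply_mem_singularContinuousSubspace (T : H →L[ℂ] H) (hT : IsSelfAdjoint T) {ψ : H}
    (hψ : ψ ∈ singularContinuousSubspace T) : T ψ ∈ singularContinuousSubspace T :=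
  IsSingularContinuous.mono hψ (spectralMeasure_apply_ac T hT ψ)

/-- The singular continuous spectrum `σ_sc(T)` of a bounded self-adjoint operator `T`: the spectrum
of the restriction of `T` to its singular continuous subspace. -/
def singularContinuousSpectrum (T : H →L[ℂ] H) (hT : IsSelfAdjoint T) : Set ℂ :=
  spectrum ℂ
    (((T.comp (singularContinuousSubspace T).subtypeL).codRestrict (singularContinuousSubspace T)
      fun ψ => apply_mem_singularContinuousSubspace T hT ψ.2) :
      singularContinuousSubspace T →L[ℂ] singularContinuousSubspace T)

/-- The point spectrum `σ_p(T)`: the set of eigenvalues of `T`. -/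
def pointSpectrum (T : H →L[ℂ] H) : Set ℂ :=
  {z | Module.End.HasEigenvalue (T : Module.End ℂ H) z}

/-- The spectrum of the self-adjoint operator `T` is purely absolutely continuous on the Borel set
`S ⊆ ℝ`: all spectral measures of `T` are absolutely continuous on `S` with respect to Lebesgue
measure, i.e. the range of `E_T(S)` lies in the absolutely continuous subspace. -/
def IsPurelyAbsolutelyContinuousOn (T : H →L[ℂ] H) (S : Set ℝ) : Prop :=
  ∀ ψ : H, (spectralMeasure T ψ).restrict S ≪ (volume : Measure ℝ)

end Spectral

/-- The Hilbert space `ℓ²(ℤ, ℂᴺ)`. -/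
abbrev StateSpace (N : ℕ) : Type := lp (fun _ : ℤ => EuclideanSpace ℂ (Fin N)) 2

/-- The shift `(shift k ψ) n = ψ (n + k)` on `ℓ²(ℤ, ℂᴺ)`. -/
def shift (N : ℕ) (k : ℤ) : StateSpace N →L[ℂ] StateSpace N :=
  LinearMap.mkContinuous
    { toFun := fun ψ => ⟨fun n => ψ (n + k), memℓp_gen
        (((Equiv.addRight k).summable_iff (f := fun n => ‖ψ n‖ ^ (2 : ENNReal).toReal)).2
          ((lp.memℓp ψ).summable (by norm_num)))⟩
      map_add' := fun _ _ => rfl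
      map_smul' := fun _ _ => rfl } 1
    (fun ψ => by
      rw [one_mul]
      refine lp.norm_le_of_tsum_le (by norm_num) (norm_nonneg _) ?_
      rw [lp.norm_rpow_eq_tsum (by norm_num) ψ]
      exact ((Equiv.addRight k).tsum_eq (fun n => ‖ψ n‖ ^ (2 : ENNReal).toReal)).le)

/-- The operator `(blockMul M ψ) n = M (ψ n)` on `ℓ²(ℤ, ℂᴺ)`. -/
def blockMul {N : ℕ} (M : Matrix (Fin N) (Fin N) ℂ) : StateSpace N →L[ℂ] StateSpace N :=
  lp.mapCLM 2 (fun _ : ℤ => Matrix.toEuclideanCLM (n := Fin N) (𝕜 := ℂ) M)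
    (norm_nonneg (Matrix.toEuclideanCLM (n := Fin N) (𝕜 := ℂ) M)) (fun _ => le_rfl)

/-- The free block Jacobi operator
`(H₀ ψ) n = A* ψ (n - 1) + B ψ n + A ψ (n + 1)` on `ℓ²(ℤ, ℂᴺ)`. -/
def freeOperator {N : ℕ} (A B : Matrix (Fin N) (Fin N) ℂ) : StateSpace N →L[ℂ] StateSpace N :=
  blockMul A.conjTranspose ∘L shift N (-1) + blockMul B + blockMul A ∘L shift N 1

theorem freeOperator_apply {N : ℕ} (A B : Matrix (Fin N) (Fin N) ℂ) (ψ : StateSpace N) (n : ℤ) :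
    freeOperator A B ψ n =
      Matrix.toEuclideanCLM (n := Fin N) (𝕜 := ℂ) A.conjTranspose (ψ (n - 1)) +
        Matrix.toEuclideanCLM (n := Fin N) (𝕜 := ℂ) B (ψ n) +
        Matrix.toEuclideanCLM (n := Fin N) (𝕜 := ℂ) A (ψ (n + 1)) :=
  rfl

theorem inner_shift {N : ℕ} (k : ℤ) (φ ψ : StateSpace N) :
    ⟪shift N k φ, ψ⟫_ℂ = ⟪φ, shift N (-k) ψ⟫_ℂ := by
  rw [lp.inner_eq_tsum, lp.inner_eq_tsum,
    ← (Equiv.addRight k).tsum_eq (fun n => ⟪φ n, shift N (-k) ψ n⟫_ℂ)]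
  refine tsum_congr fun n => ?_
  change ⟪φ (n + k), ψ n⟫_ℂ = ⟪φ (n + k), ψ (n + k + -k)⟫_ℂ
  rw [add_neg_cancel_right]

theorem inner_blockMul {N : ℕ} (M : Matrix (Fin N) (Fin N) ℂ) (φ ψ : StateSpace N) :
    ⟪blockMul M φ, ψ⟫_ℂ = ⟪φ, blockMul M.conjTranspose ψ⟫_ℂ := by
  rw [lp.inner_eq_tsum, lp.inner_eq_tsum]
  refine tsum_congr fun n => ?_
  change ⟪Matrix.toEuclideanCLM (n := Fin N) (𝕜 := ℂ) M (φ n), ψ n⟫_ℂ =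
    ⟪φ n, Matrix.toEuclideanCLM (n := Fin N) (𝕜 := ℂ) (star M) (ψ n)⟫_ℂ
  rw [map_star, ContinuousLinearMap.star_eq_adjoint, ContinuousLinearMap.adjoint_inner_right]

theorem blockMul_shift {N : ℕ} (M : Matrix (Fin N) (Fin N) ℂ) (k : ℤ) (ψ : StateSpace N) :
    blockMul M (shift N k ψ) = shift N k (blockMul M ψ) :=
  rfl

theorem isSelfAdjoint_freeOperator {N : ℕ} (A B : Matrix (Fin N) (Fin N) ℂ)
    (hB : B.IsHermitian) : IsSelfAdjoint (freeOperator A B) := by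
  rw [ContinuousLinearMap.isSelfAdjoint_iff_isSymmetric]
  intro φ ψ
  change ⟪blockMul A.conjTranspose (shift N (-1) φ) + blockMul B φ + blockMul A (shift N 1 φ),
      ψ⟫_ℂ =
    ⟪φ, blockMul A.conjTranspose (shift N (-1) ψ) + blockMul B ψ + blockMul A (shift N 1 ψ)⟫_ℂ
  simp only [inner_add_left, inner_add_right, inner_blockMul, inner_shift, neg_neg,
    Matrix.conjTranspose_conjTranspose, hB.eq, ← blockMul_shift]
  ring

/-- The reduced operators (symbol) `h(p) = e^{-ip} A + e^{ip} A* + B`. -/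
def symbol {N : ℕ} (A B : Matrix (Fin N) (Fin N) ℂ) (p : ℝ) : Matrix (Fin N) (Fin N) ℂ :=
  Complex.exp (-(Complex.I * p)) • A + Complex.exp (Complex.I * p) • A.conjTranspose + B

/-- `lam j`, `W j` are analytic branches of eigenvalues and eigenvectors of `h(p)`: they are real
analytic on (a neighbourhood of) `[-π, π]`, and for all `p ∈ [-π, π]` the vectors `W j p` form an
orthonormal basis of `ℂᴺ` with `h(p) (W j p) = lam j p • W j p`. In particular the numbers `lam j p`
are the eigenvalues of `h(p)` repeated according to multiplicity. -/
structure IsAnalyticEigenbasis {N : ℕ} (A B : Matrix (Fin N) (Fin N) ℂ)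
    (lam : Fin N → ℝ → ℝ) (W : Fin N → ℝ → EuclideanSpace ℂ (Fin N)) : Prop where
  analytic_eigenvalue : ∀ j, AnalyticOnNhd ℝ (lam j) (Set.Icc (-Real.pi) Real.pi)
  analytic_eigenvector : ∀ j, AnalyticOnNhd ℝ (W j) (Set.Icc (-Real.pi) Real.pi)
  orthonormal : ∀ p ∈ Set.Icc (-Real.pi) Real.pi, Orthonormal ℂ fun j => W j p
  eigen : ∀ p ∈ Set.Icc (-Real.pi) Real.pi, ∀ j,
    Matrix.toEuclideanCLM (n := Fin N) (𝕜 := ℂ) (symbol A B p) (W j p) = (lam j p : ℂ) • W j p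

/-- The critical set `κ(lam) = {lam(p) | p ∈ [-π, π], lam'(p) = 0}` of one branch. -/
def branchCriticalSet (lam : ℝ → ℝ) : Set ℝ :=
  lam '' {p | p ∈ Set.Icc (-Real.pi) Real.pi ∧ deriv lam p = 0}

/-- The critical set `κ(H₀) = ⋃ j, κ(lam j)`. -/
def criticalSet {N : ℕ} (lam : Fin N → ℝ → ℝ) : Set ℝ :=
  ⋃ j, branchCriticalSet (lam j)

end

end BlockJacobi

/-! Part (a) is Rellich's theorem in one real variable. The eigenvalues of h(p) are the roots of its
characteristic polynomial, a monic real-rooted family with analytic coefficients. Local analyticity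
of the roots (`hasAnalyticRootsAt_of_isRealRooted`) goes by induction on the degree. After
subtracting the mean of the roots, the sum of their squares S is analytic, and nonnegative because
the roots are real. If S vanishes near t₀, so do all the roots. Otherwise S vanishes to an even
order 2m, the roots are O(|t - t₀|^m), and division by (t - t₀)^m leaves an analytic family whose
value at t₀ has mean zero but is not a power of X. That value splits into coprime factors, and the
inverse function theorem continues the splitting analytically (`exists_analytic_factorization`).
Local branches glue along [-π, π], since two analytic parametrizations of the roots differ by a
fixed permutation.

Eigenvectors are built one at a time. The next one is a kernel vector of h(p) - λ_k(p) stacked on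
the adjoints of the earlier ones. Analytic functions on an interval form an integral domain, so a
square matrix over them with zero determinant has a nonzero analytic kernel vector. Its zeros are
finite in number and can be divided out, after which it can be normalized.

Part (b) compares moments instead of constructing the Fourier transform as a unitary map. For a
vector with value v at one site, ⟨ψ, H₀^k ψ⟩ = (2π)⁻¹ ∫ Σ_j λ_j(p)^k |⟨W_j(p), v⟩|² dp. A compactly
supported measure is determined by its moments, so the spectral measure is a sum of push-forwards
under λ_j of weighted Lebesgue measure (`spectralMeasure_single`). Null sets pass to all vectors,
because the vectors whose spectral measure vanishes on a given set form a closed subspace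
(`isClosed_nullSubspace`). Absolute continuity off κ(H₀) holds because λ_j is locally invertible
where λ_j' ≠ 0. The spectrum is read off from the supports, and the finiteness of κ(H₀) leaves no
room for singular continuous spectrum. -/

namespace BlockJacobi

/-! ### Part (a): Rellich's theorem and the analytic eigenbasis of the symbol. -/

open Polynomial Filter Topology
open scoped ContDiff

/-! ### Analytic factorization of monic polynomials -/

/-- The polynomial of degree `< n` with coefficient vector `v`. -/
noncomputable def lowerPoly (n : ℕ) : (Fin n → ℂ) →ₗ[ℂ] ℂ[X] where
  toFun v := ∑ i, C (v i) * X ^ (i : ℕ)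
  map_add' v w := by simp [add_mul, Finset.sum_add_distrib]
  map_smul' c v := by simp [Finset.smul_sum, smul_eq_C_mul, mul_assoc]

/-- The monic polynomial of degree `n` with lower coefficients `v`. -/
noncomputable def monicPoly {n : ℕ} (v : Fin n → ℂ) : ℂ[X] := X ^ n + lowerPoly n v

theorem coeff_lowerPoly {n : ℕ} (v : Fin n → ℂ) (k : ℕ) :
    (lowerPoly n v).coeff k = if h : k < n then v ⟨k, h⟩ else 0 := by
  simp only [lowerPoly, LinearMap.coe_mk, AddHom.coe_mk, finsetSum_coeff, coeff_C_mul, coeff_X_pow,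
    mul_ite, mul_one, mul_zero]
  split_ifs with h
  · rw [Finset.sum_eq_single ⟨k, h⟩]
    · simp
    · intro i _ hi
      rw [if_neg]
      rintro rfl
      exact hi rfl
    · simp
  · refine Finset.sum_eq_zero fun i _ => if_neg ?_
    have := i.2
    omega

theorem degree_lowerPoly_lt {n : ℕ} (v : Fin n → ℂ) : (lowerPoly n v).degree < n := by
  rw [degree_lt_iff_coeff_zero]
  intro m hm
  rw [coeff_lowerPoly, dif_neg (not_lt.2 hm)]

theorem lowerPoly_injective (n : ℕ) : Function.Injective (lowerPoly n) := by
  intro v w h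
  funext i
  have := congrArg (fun p => p.coeff i) h
  simpa [coeff_lowerPoly] using this

theorem monic_monicPoly {n : ℕ} (v : Fin n → ℂ) : (monicPoly v).Monic :=
  monic_X_pow_add (degree_lowerPoly_lt v)

theorem natDegree_monicPoly {n : ℕ} (v : Fin n → ℂ) : (monicPoly v).natDegree = n := by
  have h := degree_lowerPoly_lt v
  rw [monicPoly, natDegree_add_eq_left_of_degree_lt (by simpa using h), natDegree_X_pow]

theorem coeff_monicPoly {n : ℕ} (v : Fin n → ℂ) (k : ℕ) :
    (monicPoly v).coeff k = (if k = n then 1 else 0) + (lowerPoly n v).coeff k := by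
  rw [monicPoly, coeff_add, coeff_X_pow]

theorem monicPoly_coeff {n : ℕ} {p : ℂ[X]} (hp : p.Monic) (hn : p.natDegree = n) :
    monicPoly (fun i : Fin n => p.coeff i) = p := by
  ext k
  rw [coeff_monicPoly, coeff_lowerPoly]
  rcases lt_trichotomy k n with h | h | h
  · simp [h, h.ne]
  · subst hn h
    simp [hp.coeff_natDegree]
  · simp [h.ne', coeff_eq_zero_of_natDegree_lt (hn.trans_lt h)]

/-- The `k`-th coefficient of a polynomial of degree `< n`, as a functional of its coefficient
vector. -/
noncomputable def lowerCoeff (n k : ℕ) : (Fin n → ℂ) →L[ℂ] ℂ :=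
  LinearMap.toContinuousLinearMap (lcoeff ℂ k ∘ₗ lowerPoly n)

theorem lowerCoeff_apply (n k : ℕ) (v : Fin n → ℂ) :
    lowerCoeff n k v = (lowerPoly n v).coeff k := rfl

/-- The coefficients of the product of two monic polynomials, as a function of the coefficients of
the factors. -/
noncomputable def mulCoeffs (m n : ℕ) (x : (Fin m → ℂ) × (Fin n → ℂ)) : Fin (m + n) → ℂ :=
  fun i => (monicPoly x.1 * monicPoly x.2).coeff i

/-- The derivative of `mulCoeffs`. -/
noncomputable def mulCoeffsDeriv (m n : ℕ) (x : (Fin m → ℂ) × (Fin n → ℂ)) :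
    ((Fin m → ℂ) × (Fin n → ℂ)) →ₗ[ℂ] (Fin (m + n) → ℂ) where
  toFun y i := (lowerPoly m y.1 * monicPoly x.2 + monicPoly x.1 * lowerPoly n y.2).coeff i
  map_add' y z := by
    funext i
    simp only [Prod.fst_add, Prod.snd_add, map_add, add_mul, mul_add, coeff_add, Pi.add_apply]
    ring
  map_smul' c y := by
    funext i
    simp [mul_add]

theorem analyticAt_coeff_monicPoly {n : ℕ} (v : Fin n → ℂ) (k : ℕ) :
    AnalyticAt ℂ (fun v : Fin n → ℂ => (monicPoly v).coeff k) v := by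
  simp only [coeff_monicPoly, ← lowerCoeff_apply]
  exact analyticAt_const.add ((lowerCoeff n k).analyticAt v)

theorem hasFDerivAt_coeff_monicPoly {n : ℕ} (v : Fin n → ℂ) (k : ℕ) :
    HasFDerivAt (fun v : Fin n → ℂ => (monicPoly v).coeff k) (lowerCoeff n k) v := by
  simp only [coeff_monicPoly, ← lowerCoeff_apply]
  exact ((lowerCoeff n k).hasFDerivAt).const_add _

theorem analyticAt_mulCoeffs (m n : ℕ) (x : (Fin m → ℂ) × (Fin n → ℂ)) :
    AnalyticAt ℂ (mulCoeffs m n) x := by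
  refine AnalyticAt.pi fun i => ?_
  simp only [mulCoeffs, coeff_mul]
  refine Finset.analyticAt_fun_sum _ fun j _ => ?_
  exact ((analyticAt_coeff_monicPoly x.1 j.1).comp_of_eq analyticAt_fst rfl).mul
    ((analyticAt_coeff_monicPoly x.2 j.2).comp_of_eq analyticAt_snd rfl)

theorem hasFDerivAt_mulCoeffs (m n : ℕ) (x : (Fin m → ℂ) × (Fin n → ℂ)) :
    HasFDerivAt (mulCoeffs m n) (LinearMap.toContinuousLinearMap (mulCoeffsDeriv m n x)) x := by
  rw [hasFDerivAt_pi']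
  intro i
  have h := HasFDerivAt.fun_sum (u := Finset.HasAntidiagonal.antidiagonal (i : ℕ)) fun j _ =>
    ((hasFDerivAt_coeff_monicPoly x.1 j.1).comp x hasFDerivAt_fst).mul
      ((hasFDerivAt_coeff_monicPoly x.2 j.2).comp x hasFDerivAt_snd)
  have h2 : (fun x => mulCoeffs m n x i) = fun x => ∑ j ∈ Finset.HasAntidiagonal.antidiagonal (i : ℕ),
      (monicPoly x.1).coeff j.1 * (monicPoly x.2).coeff j.2 := by
    funext y
    exact coeff_mul _ _ _
  rw [h2]
  refine h.congr_fderiv ?_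
  refine ContinuousLinearMap.ext fun y => ?_
  change _ = (lowerPoly m y.1 * monicPoly x.2 + monicPoly x.1 * lowerPoly n y.2).coeff i
  rw [coeff_add, coeff_mul, coeff_mul, ← Finset.sum_add_distrib]
  simp only [sum_apply]
  refine Finset.sum_congr rfl fun j _ => ?_
  simp [lowerCoeff_apply]
  ring

/-- If v G + F w = 0 with F, G coprime, then F divides v. Since deg v < deg F this forces v = 0, and
then w = 0. This nondegeneracy is what the inverse function theorem needs. -/
theorem mulCoeffsDeriv_injective {m n : ℕ} {x : (Fin m → ℂ) × (Fin n → ℂ)}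
    (hx : IsCoprime (monicPoly x.1) (monicPoly x.2)) :
    Function.Injective (mulCoeffsDeriv m n x) := by
  rw [← LinearMap.ker_eq_bot, LinearMap.ker_eq_bot']
  rintro ⟨v, w⟩ h
  have hdeg : (lowerPoly m v * monicPoly x.2 + monicPoly x.1 * lowerPoly n w).degree <
      ((m + n : ℕ) : WithBot ℕ) := by
    have h1 : (monicPoly x.1).degree = (m : WithBot ℕ) := by
      rw [degree_eq_natDegree (monic_monicPoly _).ne_zero, natDegree_monicPoly]
    have h2 : (monicPoly x.2).degree = (n : WithBot ℕ) := by
      rw [degree_eq_natDegree (monic_monicPoly _).ne_zero, natDegree_monicPoly]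
    refine (degree_add_le _ _).trans_lt (max_lt ?_ ?_)
    · rw [degree_mul, h2, Nat.cast_add]
      exact WithBot.add_lt_add_right (by simp) (degree_lowerPoly_lt v)
    · rw [degree_mul, h1, Nat.cast_add]
      exact WithBot.add_lt_add_left (by simp) (degree_lowerPoly_lt w)
  have h0 : lowerPoly m v * monicPoly x.2 + monicPoly x.1 * lowerPoly n w = 0 := by
    ext k
    by_cases hk : k < m + n
    · exact congrFun h ⟨k, hk⟩
    · rw [coeff_zero]
      exact (degree_lt_iff_coeff_zero _ _).1 hdeg k (not_lt.1 hk)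
  have hd : monicPoly x.1 ∣ lowerPoly m v := by
    refine hx.dvd_of_dvd_mul_right ⟨-lowerPoly n w, ?_⟩
    linear_combination h0
  have hv : lowerPoly m v = 0 := by
    refine eq_zero_of_dvd_of_degree_lt hd ?_
    rw [degree_eq_natDegree (monic_monicPoly x.1).ne_zero, natDegree_monicPoly]
    exact degree_lowerPoly_lt v
  have hw : lowerPoly n w = 0 := by
    rw [hv, zero_mul, zero_add] at h0
    exact (mul_eq_zero.1 h0).resolve_left (monic_monicPoly x.1).ne_zero
  exact Prod.ext (lowerPoly_injective m (hv.trans (map_zero _).symm))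
    (lowerPoly_injective n (hw.trans (map_zero _).symm))

/-- A coprime factorization of a monic polynomial extends to an analytic family. -/
theorem exists_analytic_factorization {m n : ℕ} {P : ℝ → ℂ[X]} {t₀ : ℝ}
    (hP : ∀ t, (P t).Monic) (hdeg : ∀ t, (P t).natDegree = m + n)
    (hcoeff : ∀ k, AnalyticAt ℝ (fun t => (P t).coeff k) t₀) {F G : ℂ[X]} (hF : F.Monic)
    (hFm : F.natDegree = m) (hG : G.Monic) (hGn : G.natDegree = n) (hFG : IsCoprime F G)
    (h : P t₀ = F * G) :
    ∃ (v : ℝ → Fin m → ℂ) (w : ℝ → Fin n → ℂ), AnalyticAt ℝ v t₀ ∧ AnalyticAt ℝ w t₀ ∧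
      ∀ᶠ t in 𝓝 t₀, P t = monicPoly (v t) * monicPoly (w t) := by
  set x : (Fin m → ℂ) × (Fin n → ℂ) := (fun i => F.coeff i, fun i => G.coeff i) with hx
  have hxF : monicPoly x.1 = F := monicPoly_coeff hF hFm
  have hxG : monicPoly x.2 = G := monicPoly_coeff hG hGn
  have hinj : Function.Injective (mulCoeffsDeriv m n x) :=
    mulCoeffsDeriv_injective (by rwa [hxF, hxG])
  -- Both sides have dimension m + n, so injectivity of the derivative suffices.
  let e : ((Fin m → ℂ) × (Fin n → ℂ)) ≃L[ℂ] (Fin (m + n) → ℂ) :=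
    (LinearMap.linearEquivOfInjective (mulCoeffsDeriv m n x) hinj
      (by simp)).toContinuousLinearEquiv
  have he : HasFDerivAt (mulCoeffs m n) (e : _ →L[ℂ] _) x := by
    refine (hasFDerivAt_mulCoeffs m n x).congr_fderiv ?_
    exact ContinuousLinearMap.ext fun y => rfl
  have hc : ContDiffAt ℂ ω (mulCoeffs m n) x := (analyticAt_mulCoeffs m n x).contDiffAt
  have hω : (ω : WithTop ℕ∞) ≠ 0 := by simp
  let g := hc.localInverse he hω
  have hg : AnalyticAt ℂ g (mulCoeffs m n x) := (hc.to_localInverse he hω).analyticAt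
  let a : ℝ → Fin (m + n) → ℂ := fun t i => (P t).coeff i
  have ha : AnalyticAt ℝ a t₀ := AnalyticAt.pi fun i => hcoeff i
  have hat : a t₀ = mulCoeffs m n x := by
    funext i
    simp only [a, mulCoeffs, hxF, hxG, h]
  -- The inverse is complex analytic; it is composed with a real analytic curve, hence the
  -- restriction of scalars.
  have hga : AnalyticAt ℝ (fun t => g (a t)) t₀ :=
    (hg.restrictScalars (𝕜 := ℝ)).comp_of_eq ha hat
  refine ⟨fun t => (g (a t)).1, fun t => (g (a t)).2, analyticAt_fst.comp hga,
    analyticAt_snd.comp hga, ?_⟩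
  have hr : ∀ᶠ y in 𝓝 (mulCoeffs m n x), mulCoeffs m n (g y) = y :=
    (hc.hasStrictFDerivAt' he hω).eventually_right_inverse
  have hr' := (hat ▸ ha.continuousAt.tendsto).eventually hr
  filter_upwards [hr'] with t ht
  rw [← monicPoly_coeff (hP t) (hdeg t),
    ← monicPoly_coeff ((monic_monicPoly (g (a t)).1).mul (monic_monicPoly (g (a t)).2))
      (n := m + n) (by rw [(monic_monicPoly _).natDegree_mul (monic_monicPoly _),
        natDegree_monicPoly, natDegree_monicPoly])]
  exact congrArg monicPoly ht.symm

/-! ### Local analytic roots of real-rooted polynomials -/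

/-- An analytic function of size `O(|t - t₀| ^ k)` is divisible by `(t - t₀) ^ k`. -/
theorem exists_eq_pow_smul_of_norm_le {f : ℝ → ℂ} {t₀ : ℝ} (hf : AnalyticAt ℝ f t₀) {k : ℕ} {c : ℝ}
    (hc : ∀ᶠ t in 𝓝[≠] t₀, ‖f t‖ ≤ c * |t - t₀| ^ k) :
    ∃ g : ℝ → ℂ, AnalyticAt ℝ g t₀ ∧ ∀ᶠ t in 𝓝 t₀, f t = (t - t₀) ^ k • g t := by
  rw [← natCast_le_analyticOrderAt hf]
  by_contra! hlt
  obtain ⟨d, hd⟩ := ENat.ne_top_iff_exists.1 (ne_top_of_lt hlt)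
  rw [← hd] at hlt
  have hdk : d < k := by exact_mod_cast hlt
  obtain ⟨g, hg, hg0, hfg⟩ := (hf.analyticOrderAt_eq_natCast).1 hd.symm
  -- If the order d were less than k, cancelling |t - t₀|^d would leave a bound tending to 0,
  -- against g t₀ ≠ 0.
  have hle : ∀ᶠ t in 𝓝[≠] t₀, ‖g t‖ ≤ c * |t - t₀| ^ (k - d) := by
    filter_upwards [hc, hfg.filter_mono nhdsWithin_le_nhds, self_mem_nhdsWithin] with t h1 h2 h3
    have hpos : 0 < |t - t₀| := abs_pos.2 (sub_ne_zero.2 h3)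
    rw [h2, norm_smul, norm_pow, Real.norm_eq_abs, ← Nat.sub_add_cancel hdk.le, pow_add,
      ← mul_assoc, mul_comm] at h1
    exact le_of_mul_le_mul_right h1 (pow_pos hpos d)
  have h1 : Tendsto (fun t => ‖g t‖) (𝓝[≠] t₀) (𝓝 ‖g t₀‖) :=
    (hg.continuousAt.norm.tendsto).mono_left nhdsWithin_le_nhds
  have h2 : Tendsto (fun t => c * |t - t₀| ^ (k - d)) (𝓝[≠] t₀) (𝓝 0) := by
    have hcont : Continuous fun t => c * |t - t₀| ^ (k - d) := by fun_prop
    have := (hcont.tendsto t₀).mono_left (nhdsWithin_le_nhds (s := {t₀}ᶜ))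
    simpa [(Nat.sub_pos_of_lt hdk).ne'] using this
  have := le_of_tendsto_of_tendsto h1 h2 hle
  exact hg0 (norm_le_zero_iff.1 this)

/-- Newton's identity, by adjoining one element a at a time: the second elementary symmetric
function grows by a times the sum of the others. -/
theorem sum_sq_eq_sum_sq_add_esymm_two (s : Multiset ℂ) :
    s.sum ^ 2 = (s.map (· ^ 2)).sum + 2 * s.esymm 2 := by
  induction s using Multiset.induction_on with
  | empty =>
    have h : Multiset.powersetCard 2 (0 : Multiset ℂ) = 0 := Multiset.powersetCard_zero_right 1
    simp [Multiset.esymm, h]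
  | cons a s ih =>
    have h1 : (a ::ₘ s).esymm 2 = s.esymm 2 + a * s.sum := by
      simp only [Multiset.esymm, Multiset.powersetCard_cons, Multiset.powersetCard_one,
        Multiset.map_add, Multiset.sum_add, Multiset.map_map]
      simpa using Multiset.sum_map_mul_left (s := s) (a := a) (f := id)
    rw [h1, Multiset.sum_cons, Multiset.map_cons, Multiset.sum_cons]
    linear_combination ih

/-- The sum of the squares of the roots of a monic polynomial whose roots have sum zero. -/
theorem sum_sq_roots {p : ℂ[X]} (hp : p.Monic) {n : ℕ} (hn : p.natDegree = n + 2)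
    (h0 : p.coeff (n + 1) = 0) : (p.roots.map (· ^ 2)).sum = -2 * p.coeff n := by
  have hs := IsAlgClosed.splits p
  have hcard : p.roots.card = p.natDegree := hs.natDegree_eq_card_roots.symm
  have h1 := Polynomial.coeff_eq_esymm_roots_of_card hcard (k := n + 1) (by omega)
  have h2 := Polynomial.coeff_eq_esymm_roots_of_card hcard (k := n) (by omega)
  rw [hp.leadingCoeff, hn, h0] at h1
  rw [hp.leadingCoeff, hn] at h2
  have e1 : n + 2 - (n + 1) = 1 := by omega
  have e2 : n + 2 - n = 2 := by omega
  rw [e1] at h1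
  rw [e2] at h2
  have h3 : p.roots.sum = 0 := by
    have : p.roots.esymm 1 = p.roots.sum := by
      simp [Multiset.esymm, Multiset.powersetCard_one]
    rw [← this]
    linear_combination h1
  have h4 := sum_sq_eq_sum_sq_add_esymm_two p.roots
  rw [h3] at h4
  linear_combination -h4 + 2 * h2

/-- All roots of `p` are real. -/
def IsRealRooted (p : ℂ[X]) : Prop := ∀ z, p.IsRoot z → z.im = 0

theorem IsRealRooted.of_dvd {p q : ℂ[X]} (hp : IsRealRooted p) (h : q ∣ p) : IsRealRooted q :=
  fun z hz => hp z (hz.dvd h)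

/-- Real numbers have nonnegative squares, so nothing cancels and the sum dominates each term. This
is the way real-rootedness turns one coefficient into a bound on all roots. -/
theorem sum_map_sq_of_real (s : Multiset ℂ) (hs : ∀ z ∈ s, z.im = 0) :
    (s.map (· ^ 2)).sum.im = 0 ∧ 0 ≤ (s.map (· ^ 2)).sum.re ∧
      ∀ z ∈ s, ‖z‖ ^ 2 ≤ (s.map (· ^ 2)).sum.re := by
  induction s using Multiset.induction_on with
  | empty => simp
  | cons a s ih =>
    obtain ⟨h1, h2, h3⟩ := ih fun z hz => hs z (Multiset.mem_cons_of_mem hz)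
    have ha : a.im = 0 := hs a (Multiset.mem_cons_self a s)
    have ha' : ‖a‖ ^ 2 = (a ^ 2).re := by
      rw [Complex.sq_norm, Complex.normSq_apply, pow_two, Complex.mul_re, ha]
      ring
    have ha2 : 0 ≤ (a ^ 2).re := ha' ▸ sq_nonneg ‖a‖
    rw [Multiset.map_cons, Multiset.sum_cons, Complex.add_im, Complex.add_re]
    refine ⟨?_, by linarith, ?_⟩
    · rw [h1, pow_two, Complex.mul_im, ha]
      ring
    · intro z hz
      rcases Multiset.mem_cons.1 hz with rfl | hz
      · linarith
      · linarith [h3 z hz]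

/-- A monic family `P` has analytic roots near `t₀`. -/
def HasAnalyticRootsAt (P : ℝ → ℂ[X]) (n : ℕ) (t₀ : ℝ) : Prop :=
  ∃ lam : Fin n → ℝ → ℂ, (∀ i, AnalyticAt ℝ (lam i) t₀) ∧
    ∀ᶠ t in 𝓝 t₀, P t = ∏ i, (X - C (lam i t))

theorem HasAnalyticRootsAt.mul {P Q R : ℝ → ℂ[X]} {m n : ℕ} {t₀ : ℝ}
    (hP : HasAnalyticRootsAt P m t₀) (hQ : HasAnalyticRootsAt Q n t₀)
    (hR : ∀ᶠ t in 𝓝 t₀, R t = P t * Q t) : HasAnalyticRootsAt R (m + n) t₀ := by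
  obtain ⟨lam, hlam, h1⟩ := hP
  obtain ⟨mu, hmu, h2⟩ := hQ
  refine ⟨Fin.addCases lam mu, fun i => ?_, ?_⟩
  · induction i using Fin.addCases with
    | left i => simpa using hlam i
    | right i => simpa using hmu i
  · filter_upwards [h1, h2, hR] with t e1 e2 e3
    rw [e3, e1, e2, Fin.prod_univ_add]
    simp

theorem scaleRoots_prod_X_sub_C {ι : Type*} (s : Finset ι) (lam : ι → ℂ) (c : ℂ) :
    (∏ i ∈ s, (X - C (lam i))).scaleRoots c = ∏ i ∈ s, (X - C (c * lam i)) := by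
  classical
  induction s using Finset.induction_on with
  | empty => simp
  | insert a s ha ih =>
    rw [Finset.prod_insert ha, Finset.prod_insert ha, mul_scaleRoots_of_noZeroDivisors, ih,
      X_sub_C_scaleRoots, mul_comm c]

theorem HasAnalyticRootsAt.scaleRoots {P Q : ℝ → ℂ[X]} {n : ℕ} {t₀ : ℝ} {c : ℝ → ℂ}
    (hQ : HasAnalyticRootsAt Q n t₀) (hc : AnalyticAt ℝ c t₀)
    (hP : ∀ᶠ t in 𝓝 t₀, P t = (Q t).scaleRoots (c t)) : HasAnalyticRootsAt P n t₀ := by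
  obtain ⟨lam, hlam, h1⟩ := hQ
  refine ⟨fun i t => c t * lam i t, fun i => hc.mul (hlam i), ?_⟩
  filter_upwards [h1, hP] with t e1 e2
  rw [e2, e1, scaleRoots_prod_X_sub_C]

theorem coeff_X_sub_C_pow (z : ℂ) (n k : ℕ) :
    ((X - C z) ^ n).coeff k = (-z) ^ (n - k) * (n.choose k : ℂ) := by
  rw [sub_eq_add_neg, ← C_neg, coeff_X_add_C_pow]

/-- A monic polynomial with vanishing mean of the roots which is not a power of `X` is a product of
two coprime factors of positive degree. -/
theorem exists_coprime_factorization {p : ℂ[X]} (hp : p.Monic) {n : ℕ} (hn : p.natDegree = n + 2)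
    (h0 : p.coeff (n + 1) = 0) (h1 : p.coeff n ≠ 0) :
    ∃ (k l : ℕ) (F G : ℂ[X]), k < n + 2 ∧ l < n + 2 ∧ k + l = n + 2 ∧ F.Monic ∧ F.natDegree = k ∧
      G.Monic ∧ G.natDegree = l ∧ IsCoprime F G ∧ p = F * G := by
  obtain ⟨z, hz⟩ := IsAlgClosed.exists_root p (by
    rw [degree_eq_natDegree hp.ne_zero, hn]
    exact_mod_cast (Nat.succ_ne_zero (n + 1)))
  obtain ⟨G, hG, hnd⟩ := exists_eq_pow_rootMultiplicity_mul_and_not_dvd p hp.ne_zero z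
  have hk : 0 < p.rootMultiplicity z := (rootMultiplicity_pos hp.ne_zero).2 hz
  generalize p.rootMultiplicity z = k at hG hk
  have hF : ((X - C z) ^ k).Monic := (monic_X_sub_C z).pow k
  have hGm : G.Monic := hF.of_mul_monic_left (hG ▸ hp)
  have hFd : ((X - C z) ^ k).natDegree = k := by
    rw [(monic_X_sub_C z).natDegree_pow, natDegree_X_sub_C, mul_one]
  have hsum : k + G.natDegree = n + 2 := by
    rw [← hn, hG, hF.natDegree_mul hGm, hFd]
  -- If G were constant, p would be (X - z)^(n+2). The vanishing coefficient of index n + 1 gives z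
  -- = 0, and then the coefficient of index n vanishes too.
  have hl : G.natDegree ≠ 0 := by
    intro h
    have hG1 : G = 1 := hGm.natDegree_eq_zero.1 h
    rw [hG1, mul_one] at hG
    have hkn : k = n + 2 := by omega
    subst hkn
    have e1 := coeff_X_sub_C_pow z (n + 2) (n + 1)
    rw [← hG, h0] at e1
    have e2 : n + 2 - (n + 1) = 1 := by omega
    have e3 : (n + 2).choose (n + 1) = n + 2 := by simp
    rw [e2, e3, pow_one] at e1
    have hz0 : z = 0 := by
      have : ((n + 2 : ℕ) : ℂ) ≠ 0 := Nat.cast_ne_zero.2 (by omega)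
      have := (mul_eq_zero.1 e1.symm).resolve_right this
      simpa using this
    have e4 := coeff_X_sub_C_pow z (n + 2) n
    rw [← hG, hz0] at e4
    exact h1 (by rw [e4]; simp)
  exact ⟨k, G.natDegree, _, G, by omega, by omega, hsum, hF, hFd, hGm, rfl,
    (((irreducible_X_sub_C z).coprime_iff_not_dvd).2 hnd).pow_left, hG⟩

/-- The leading coefficient of a real analytic function with nonnegative values comes with an even
power. -/
theorem even_of_nonneg_pow_smul {S u : ℝ → ℂ} {t₀ : ℝ} {d : ℕ} (hu : ContinuousAt u t₀)
    (hu0 : u t₀ ≠ 0) (hS : ∀ᶠ t in 𝓝 t₀, S t = (t - t₀) ^ d • u t)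
    (him : ∀ᶠ t in 𝓝[≠] t₀, (S t).im = 0) (hre : ∀ᶠ t in 𝓝[≠] t₀, 0 ≤ (S t).re) : Even d := by
  by_contra hodd
  rw [Nat.not_even_iff_odd] at hodd
  have hgt : 𝓝[>] t₀ ≤ 𝓝[≠] t₀ := nhdsWithin_mono _ fun x hx => ne_of_gt hx
  have hlt : 𝓝[<] t₀ ≤ 𝓝[≠] t₀ := nhdsWithin_mono _ fun x hx => ne_of_lt hx
  have hcre : ContinuousAt (fun t => (u t).re) t₀ := Complex.continuous_re.continuousAt.comp hu
  have hcim : ContinuousAt (fun t => (u t).im) t₀ := Complex.continuous_im.continuousAt.comp hu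
  -- For odd d the factor (t - t₀)^d changes sign at t₀. The limits from the right and from the left
  -- force opposite signs on Re u(t₀), so u(t₀) = 0.
  have h1 : 0 ≤ (u t₀).re := by
    refine ge_of_tendsto (hcre.tendsto.mono_left (nhdsWithin_le_nhds (s := Set.Ioi t₀))) ?_
    filter_upwards [hre.filter_mono hgt, hS.filter_mono nhdsWithin_le_nhds,
      self_mem_nhdsWithin] with t e1 e2 e3
    rw [e2, Complex.smul_re, smul_eq_mul] at e1
    exact nonneg_of_mul_nonneg_right e1 (pow_pos (sub_pos.2 e3) d)
  have h2 : (u t₀).re ≤ 0 := by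
    refine le_of_tendsto (hcre.tendsto.mono_left (nhdsWithin_le_nhds (s := Set.Iio t₀))) ?_
    filter_upwards [hre.filter_mono hlt, hS.filter_mono nhdsWithin_le_nhds,
      self_mem_nhdsWithin] with t e1 e2 e3
    rw [e2, Complex.smul_re, smul_eq_mul] at e1
    exact nonpos_of_mul_nonneg_right e1 (hodd.pow_neg (sub_neg.2 e3))
  have h3 : (u t₀).im = 0 := by
    refine tendsto_nhds_unique (hcim.tendsto.mono_left (nhdsWithin_le_nhds (s := {t₀}ᶜ))) ?_
    refine tendsto_const_nhds.congr' ?_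
    filter_upwards [him, hS.filter_mono nhdsWithin_le_nhds, self_mem_nhdsWithin] with t e1 e2 e3
    rw [e2, Complex.smul_im, smul_eq_mul] at e1
    exact ((mul_eq_zero.1 e1).resolve_left (pow_ne_zero d (sub_ne_zero.2 e3))).symm
  exact hu0 (Complex.ext (le_antisymm h2 h1) h3)

/-- `P` is a family of monic polynomials of degree `n` whose coefficients are analytic at `t₀` and
whose roots are real for all `t ≠ t₀` close to `t₀`. -/
structure IsRealRootedFamilyAt (P : ℝ → ℂ[X]) (n : ℕ) (t₀ : ℝ) : Prop where
  monic : ∀ t, (P t).Monic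
  natDegree : ∀ t, (P t).natDegree = n
  analytic : ∀ k, AnalyticAt ℝ (fun t => (P t).coeff k) t₀
  real : ∀ᶠ t in 𝓝[≠] t₀, IsRealRooted (P t)

theorem analyticAt_coeff_monicPoly_comp {n : ℕ} {v : ℝ → Fin n → ℂ} {t₀ : ℝ}
    (hv : AnalyticAt ℝ v t₀) (k : ℕ) : AnalyticAt ℝ (fun t => (monicPoly (v t)).coeff k) t₀ :=
  ((analyticAt_coeff_monicPoly (v t₀) k).restrictScalars (𝕜 := ℝ)).comp_of_eq hv rfl

/-- The two analytic factors have smaller degree and inherit real roots by divisibility, so the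
induction hypothesis applies to each. -/
theorem HasAnalyticRootsAt.of_coprime_factorization
    {P : ℝ → ℂ[X]} {n : ℕ} {t₀ : ℝ} (hP : IsRealRootedFamilyAt P n t₀)
    (ih : ∀ m < n, ∀ Q, IsRealRootedFamilyAt Q m t₀ → HasAnalyticRootsAt Q m t₀)
    {k l : ℕ} {F G : ℂ[X]} (hk : k < n) (hl : l < n) (hkl : k + l = n) (hF : F.Monic)
    (hFd : F.natDegree = k) (hG : G.Monic) (hGd : G.natDegree = l) (hFG : IsCoprime F G)
    (h : P t₀ = F * G) : HasAnalyticRootsAt P n t₀ := by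
  subst hkl
  obtain ⟨v, w, hv, hw, hvw⟩ := exists_analytic_factorization hP.monic hP.natDegree hP.analytic
    hF hFd hG hGd hFG h
  have hvw' := hvw.filter_mono (nhdsWithin_le_nhds (s := {t₀}ᶜ))
  refine HasAnalyticRootsAt.mul
    (ih k hk (fun t => monicPoly (v t)) ⟨fun t => monic_monicPoly _, fun t => natDegree_monicPoly _,
      analyticAt_coeff_monicPoly_comp hv, ?_⟩)
    (ih l hl (fun t => monicPoly (w t)) ⟨fun t => monic_monicPoly _, fun t => natDegree_monicPoly _,
      analyticAt_coeff_monicPoly_comp hw, ?_⟩) hvw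
  · filter_upwards [hP.real, hvw'] with t h1 h2
    exact h1.of_dvd (h2 ▸ dvd_mul_right _ _)
  · filter_upwards [hP.real, hvw'] with t h1 h2
    exact h1.of_dvd (h2 ▸ dvd_mul_left _ _)

/-- The size of the coefficients of a monic polynomial with roots bounded by `B`. -/
theorem norm_coeff_le_of_roots {p : ℂ[X]} (hp : p.Monic) {B : ℝ} (hB : ∀ z ∈ p.roots, ‖z‖ ≤ B)
    (i : ℕ) : ‖p.coeff i‖ ≤ B ^ (p.natDegree - i) * p.natDegree.choose i := by
  have := coeff_le_of_roots_le (f := RingHom.id ℂ) i hp (IsAlgClosed.splits _)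
    (by simpa using hB)
  simpa using this

theorem IsRealRooted.norm_sq_le {p : ℂ[X]} (hr : IsRealRooted p) (hp : p.Monic) {n : ℕ}
    (hn : p.natDegree = n + 2) (h0 : p.coeff (n + 1) = 0) :
    (-2 * p.coeff n).im = 0 ∧ 0 ≤ (-2 * p.coeff n).re ∧
      ∀ z ∈ p.roots, ‖z‖ ^ 2 ≤ (-2 * p.coeff n).re := by
  rw [← sum_sq_roots hp hn h0]
  exact sum_map_sq_of_real _ fun z hz => hr z (isRoot_of_mem_roots hz)

/-- A trace free family of real-rooted polynomials is either constant or, after a rescaling of the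
roots, not a power of `X` at `t₀`. -/
theorem exists_scaleRoots {P : ℝ → ℂ[X]} {n : ℕ} {t₀ : ℝ}
    (hP : IsRealRootedFamilyAt P (n + 2) t₀) (h0 : ∀ t, (P t).coeff (n + 1) = 0) :
    (∀ᶠ t in 𝓝 t₀, P t = X ^ (n + 2)) ∨ ∃ (Q : ℝ → ℂ[X]) (m : ℕ),
      IsRealRootedFamilyAt Q (n + 2) t₀ ∧ (Q t₀).coeff (n + 1) = 0 ∧ (Q t₀).coeff n ≠ 0 ∧
        ∀ᶠ t in 𝓝 t₀, P t = (Q t).scaleRoots ((((t - t₀) ^ m : ℝ)) : ℂ) := by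
  have hS : AnalyticAt ℝ (fun t => -2 * (P t).coeff n) t₀ := analyticAt_const.mul (hP.analytic n)
  have hreal : ∀ᶠ t in 𝓝[≠] t₀, (-2 * (P t).coeff n).im = 0 ∧ 0 ≤ (-2 * (P t).coeff n).re ∧
      ∀ z ∈ (P t).roots, ‖z‖ ^ 2 ≤ (-2 * (P t).coeff n).re := by
    filter_upwards [hP.real] with t ht
    exact ht.norm_sq_le (hP.monic t) (hP.natDegree t) (h0 t)
  by_cases hz : ∀ᶠ t in 𝓝 t₀, -2 * (P t).coeff n = 0
  · left
    -- A vanishing sum of squares of real roots makes every root 0, hence every lower coefficient 0.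
    have h1 : ∀ i : Fin (n + 2), ∀ᶠ t in 𝓝 t₀, (P t).coeff i = 0 := by
      intro i
      refine ((hP.analytic i).frequently_zero_iff_eventually_zero).1 (Eventually.frequently ?_)
      filter_upwards [hreal, hz.filter_mono nhdsWithin_le_nhds] with t ⟨_, _, e1⟩ e2
      have := norm_coeff_le_of_roots (hP.monic t) (B := 0) (fun z hz => by
        have := e1 z hz
        rw [e2, Complex.zero_re] at this
        nlinarith [norm_nonneg z]) i
      rw [hP.natDegree t, zero_pow (by have := i.2; omega), zero_mul] at this
      exact norm_le_zero_iff.1 this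
    filter_upwards [eventually_all.2 h1] with t ht
    rw [← monicPoly_coeff (hP.monic t) (hP.natDegree t)]
    have : (fun i : Fin (n + 2) => (P t).coeff i) = 0 := funext ht
    rw [this, monicPoly, map_zero, add_zero]
  · right
    obtain ⟨d, u, hu, hu0, hSu⟩ := hS.exists_eventuallyEq_pow_smul_nonzero_iff.2 hz
    obtain ⟨m, rfl⟩ := even_of_nonneg_pow_smul hu.continuousAt hu0 hSu
      (hreal.mono fun t h => h.1) (hreal.mono fun t h => h.2.1)
    -- The bound is written as a square so that the root estimate below has the form |c| |t - t₀|^m.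
    obtain ⟨c, hc⟩ : ∃ c : ℝ, ∀ᶠ t in 𝓝 t₀, ‖u t‖ ≤ c ^ 2 := by
      refine ⟨‖u t₀‖ + 1, ?_⟩
      have : ‖u t₀‖ < (‖u t₀‖ + 1) ^ 2 := by nlinarith [norm_nonneg (u t₀)]
      exact (hu.continuousAt.norm.eventually_lt continuousAt_const this).mono fun t h => h.le
    have hroots : ∀ᶠ t in 𝓝[≠] t₀, ∀ z ∈ (P t).roots, ‖z‖ ≤ |c| * |t - t₀| ^ m := by
      filter_upwards [hreal, hSu.filter_mono nhdsWithin_le_nhds,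
        hc.filter_mono nhdsWithin_le_nhds] with t ⟨_, _, e1⟩ e2 e3 z hz
      refine le_of_sq_le_sq (a := ‖z‖) ?_ (by positivity)
      refine (e1 z hz).trans ((Complex.re_le_norm _).trans ?_)
      rw [e2, norm_smul, norm_pow, Real.norm_eq_abs, mul_pow, sq_abs, mul_comm, ← two_mul, mul_comm 2,
        pow_mul]
      exact mul_le_mul_of_nonneg_right e3 (by positivity)
    -- The coefficient of index i is, up to sign, an elementary symmetric function of degree n + 2 -
    -- i in roots of size O(|t - t₀|^m).
    have hdiv : ∀ i : Fin (n + 2), ∃ b : ℝ → ℂ, AnalyticAt ℝ b t₀ ∧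
        ∀ᶠ t in 𝓝 t₀, (P t).coeff i = (t - t₀) ^ (m * (n + 2 - i)) • b t := by
      intro i
      refine exists_eq_pow_smul_of_norm_le (hP.analytic i)
        (c := |c| ^ (n + 2 - i) * ((n + 2).choose i : ℝ)) ?_
      filter_upwards [hroots] with t ht
      refine (norm_coeff_le_of_roots (hP.monic t) ht i).trans (le_of_eq ?_)
      rw [hP.natDegree t, pow_mul, mul_pow]
      ring
    choose b hb hPb using hdiv
    have hPb' := eventually_all.2 hPb
    have hQP : ∀ᶠ t in 𝓝 t₀, P t = (monicPoly fun i => b i t).scaleRoots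
        ((((t - t₀) ^ m : ℝ)) : ℂ) := by
      filter_upwards [hPb'] with t ht
      rw [← monicPoly_coeff (hP.monic t) (hP.natDegree t)]
      ext k
      rw [coeff_scaleRoots, natDegree_monicPoly, coeff_monicPoly, coeff_monicPoly, coeff_lowerPoly,
        coeff_lowerPoly]
      by_cases hk : k < n + 2
      · rw [dif_pos hk, dif_pos hk, if_neg hk.ne, zero_add, zero_add, ht ⟨k, hk⟩, pow_mul,
          Complex.real_smul, mul_comm]
        push_cast
        rfl
      · rw [dif_neg hk, dif_neg hk, Nat.sub_eq_zero_of_le (not_lt.1 hk), pow_zero, mul_one]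
    have hba : AnalyticAt ℝ (fun t i => b i t) t₀ := AnalyticAt.pi hb
    refine ⟨fun t => monicPoly fun i => b i t, m, ⟨fun t => monic_monicPoly _,
      fun t => natDegree_monicPoly _, analyticAt_coeff_monicPoly_comp hba, ?_⟩, ?_, ?_, hQP⟩
    · filter_upwards [hP.real, hQP.filter_mono nhdsWithin_le_nhds, self_mem_nhdsWithin]
        with t h1 h2 h3 z hz
      have hs : (t - t₀) ^ m ≠ 0 := pow_ne_zero _ (sub_ne_zero.2 h3)
      have := h1 ((((t - t₀) ^ m : ℝ) : ℂ) * z) (by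
        rw [h2, IsRoot, scaleRoots_eval_mul, hz.eq_zero, mul_zero])
      rw [Complex.im_ofReal_mul] at this
      exact (mul_eq_zero.1 this).resolve_left hs
    · rw [coeff_monicPoly, coeff_lowerPoly, dif_pos (by omega), if_neg (by omega), zero_add]
      have : ∃ᶠ t in 𝓝[≠] t₀, b ⟨n + 1, by omega⟩ t = 0 := by
        refine Eventually.frequently ?_
        filter_upwards [(hPb ⟨n + 1, by omega⟩).filter_mono nhdsWithin_le_nhds,
          self_mem_nhdsWithin] with t h2 h3
        rw [h0 t] at h2
        exact (smul_eq_zero.1 h2.symm).resolve_left (pow_ne_zero _ (sub_ne_zero.2 h3))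
      exact (((hb _).frequently_zero_iff_eventually_zero).1 this).self_of_nhds
    · rw [coeff_monicPoly, coeff_lowerPoly, dif_pos (by omega), if_neg (by omega), zero_add]
      -- Off t₀ the power (t - t₀)^(2m) cancels from both expressions for S. By the identity theorem
      -- the equality reaches t₀, where u does not vanish.
      have : ∃ᶠ t in 𝓝[≠] t₀, -2 * b ⟨n, by omega⟩ t = u t := by
        refine Eventually.frequently ?_
        filter_upwards [(hPb ⟨n, by omega⟩).filter_mono nhdsWithin_le_nhds,
          hSu.filter_mono nhdsWithin_le_nhds, self_mem_nhdsWithin] with t h2 h3 h4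
        have e : m * (n + 2 - n) = m + m := by
          rw [Nat.add_sub_cancel_left]
          ring
        simp only [e] at h2
        rw [h2, mul_smul_comm] at h3
        exact smul_right_injective _ (pow_ne_zero (m + m) (sub_ne_zero.2 h4)) h3
      have h5 := (((analyticAt_const.mul (hb _)).frequently_eq_iff_eventually_eq hu).1
        this).self_of_nhds
      intro h6
      rw [Pi.mul_apply, h6, mul_zero] at h5
      exact hu0 h5.symm

/-- Degree one is trivial, the only root being 0. In higher degree the rescaled family splits at t₀
and the induction hypothesis applies to its factors; scaling the roots back preserves analyticity.
-/
theorem hasAnalyticRootsAt_of_coeff_eq_zero {P : ℝ → ℂ[X]} {n : ℕ} {t₀ : ℝ}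
    (hP : IsRealRootedFamilyAt P (n + 1) t₀) (h0 : ∀ t, (P t).coeff n = 0)
    (ih : ∀ m < n + 1, ∀ Q, IsRealRootedFamilyAt Q m t₀ → HasAnalyticRootsAt Q m t₀) :
    HasAnalyticRootsAt P (n + 1) t₀ := by
  have hX : (∀ᶠ t in 𝓝 t₀, P t = X ^ (n + 1)) → HasAnalyticRootsAt P (n + 1) t₀ := fun h =>
    ⟨fun _ _ => 0, fun i => analyticAt_const, h.mono fun t ht => by simp [ht]⟩
  rcases n with _ | n
  · refine hX (Eventually.of_forall fun t => ?_)
    rw [← monicPoly_coeff (hP.monic t) (hP.natDegree t)]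
    have : (fun i : Fin (0 + 1) => (P t).coeff i) = 0 := by
      funext i
      rw [Fin.fin_one_eq_zero i]
      exact h0 t
    rw [this, monicPoly, map_zero, add_zero]
  · rcases exists_scaleRoots hP h0 with h | ⟨Q, m, hQ, h1, h2, hPQ⟩
    · exact hX h
    · obtain ⟨k, l, F, G, hk, hl, hkl, hF, hFd, hG, hGd, hFG, h⟩ :=
        exists_coprime_factorization (hQ.monic t₀) (hQ.natDegree t₀) h1 h2
      refine (HasAnalyticRootsAt.of_coprime_factorization hQ ih hk hl hkl hF hFd hG hGd hFG
        h).scaleRoots ?_ hPQ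
      exact (Complex.ofRealCLM.analyticAt _).comp ((analyticAt_id.sub analyticAt_const).pow m)

/-- Expanding (X - c)^j makes each coefficient polynomial in c and the coefficients of P. -/
theorem analyticAt_coeff_comp_X_sub_C {P : ℝ → ℂ[X]} {n : ℕ} {t₀ : ℝ}
    (hn : ∀ t, (P t).natDegree = n) (hP : ∀ k, AnalyticAt ℝ (fun t => (P t).coeff k) t₀)
    {c : ℝ → ℂ} (hc : AnalyticAt ℝ c t₀) (k : ℕ) :
    AnalyticAt ℝ (fun t => ((P t).comp (X - C (c t))).coeff k) t₀ := by
  have h : ∀ t, ((P t).comp (X - C (c t))).coeff k = ∑ j ∈ Finset.range (n + 1),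
      (P t).coeff j * ((-c t) ^ (j - k) * (j.choose k : ℂ)) := by
    intro t
    rw [comp_eq_sum_left, sum_over_range' _ (by simp) (n + 1) (by rw [hn t]; omega),
      finsetSum_coeff]
    exact Finset.sum_congr rfl fun j _ => by rw [coeff_C_mul, coeff_X_sub_C_pow]
  simp only [h]
  exact Finset.analyticAt_fun_sum _ fun j _ => (hP j).mul ((hc.neg.pow _).mul analyticAt_const)

/-- **Rellich's theorem** for real-rooted polynomials: the roots of a real-rooted analytic family
are locally analytic. -/
theorem hasAnalyticRootsAt_of_isRealRooted (n : ℕ) {P : ℝ → ℂ[X]} {t₀ : ℝ}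
    (hP : IsRealRootedFamilyAt P n t₀) : HasAnalyticRootsAt P n t₀ := by
  induction n using Nat.strong_induction_on generalizing P with
  | _ n ih =>
  rcases n with _ | n
  · refine ⟨fun _ _ => 0, fun i => analyticAt_const, Eventually.of_forall fun t => ?_⟩
    rw [(hP.monic t).natDegree_eq_zero.1 (hP.natDegree t)]
    simp
  have hn0 : ((n + 1 : ℕ) : ℂ) ≠ 0 := Nat.cast_ne_zero.2 (Nat.succ_ne_zero n)
  -- Minus the mean of the roots: composing with X - c adds c to each root, so the shifted roots
  -- have sum zero.
  set c : ℝ → ℂ := fun t => (P t).coeff n / ((n + 1 : ℕ) : ℂ) with hc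
  have hca : AnalyticAt ℝ c t₀ := (hP.analytic n).div_const
  have hmonic : ∀ t, ((P t).comp (X - C (c t))).Monic := fun t =>
    (hP.monic t).comp (monic_X_sub_C _) (by simp)
  have hdeg : ∀ t, ((P t).comp (X - C (c t))).natDegree = n + 1 := fun t => by
    rw [natDegree_comp, natDegree_X_sub_C, mul_one, hP.natDegree t]
  have hroots : ∀ t, (P t).coeff n = -(P t).roots.sum := fun t => by
    have h1 := (IsAlgClosed.splits (P t)).nextCoeff_eq_neg_sum_roots_of_monic (hP.monic t)
    rw [← h1, nextCoeff_of_natDegree_pos (by rw [hP.natDegree t]; omega), hP.natDegree t]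
    rfl
  have hfam : IsRealRootedFamilyAt (fun t => (P t).comp (X - C (c t))) (n + 1) t₀ := by
    refine ⟨hmonic, hdeg, analyticAt_coeff_comp_X_sub_C hP.natDegree hP.analytic hca, ?_⟩
    filter_upwards [hP.real] with t ht z hz
    have h1 : (P t).IsRoot (z - c t) := by simpa [IsRoot, eval_comp] using hz
    have h2 := ht _ h1
    have h3 : (c t).im = 0 := by
      simp only [hc]
      rw [hroots t, Complex.div_natCast_im, Complex.neg_im]
      have : ∀ s : Multiset ℂ, (∀ z ∈ s, z.im = 0) → s.sum.im = 0 := by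
        intro s
        induction s using Multiset.induction_on with
        | empty => simp
        | cons a s ih =>
          intro h
          rw [Multiset.sum_cons, Complex.add_im, h a (Multiset.mem_cons_self a s),
            ih fun z hz => h z (Multiset.mem_cons_of_mem hz), add_zero]
      rw [this _ fun z hz => ht z (isRoot_of_mem_roots hz), neg_zero, zero_div]
    rwa [Complex.sub_im, h3, sub_zero] at h2
  have hzero : ∀ t, ((P t).comp (X - C (c t))).coeff n = 0 := by
    intro t
    rw [comp_eq_sum_left, sum_over_range' _ (by simp) (n + 2) (by rw [hP.natDegree t]; omega),
      finsetSum_coeff, Finset.sum_range_succ, Finset.sum_range_succ, Finset.sum_eq_zero]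
    · have hl : (P t).coeff (n + 1) = 1 := by
        rw [← hP.natDegree t]
        exact (hP.monic t).coeff_natDegree
      rw [coeff_C_mul, coeff_C_mul, coeff_X_sub_C_pow, coeff_X_sub_C_pow, hl]
      have : (P t).coeff n = c t * ((n + 1 : ℕ) : ℂ) := by
        simp only [hc]
        field_simp
      rw [this, Nat.sub_self, Nat.add_sub_cancel_left]
      simp
    · intro j hj
      rw [Finset.mem_range] at hj
      rw [coeff_C_mul, coeff_X_sub_C_pow, Nat.choose_eq_zero_of_lt hj]
      simp
  obtain ⟨lam, hlam, h⟩ := hasAnalyticRootsAt_of_coeff_eq_zero hfam hzero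
    fun m hm Q hQ => ih m hm hQ
  refine ⟨fun i t => lam i t - c t, fun i => (hlam i).sub hca, ?_⟩
  filter_upwards [h] with t ht
  have h1 : P t = ((P t).comp (X - C (c t))).comp (X + C (c t)) := by
    rw [comp_assoc]
    simp
  rw [h1, ht, prod_comp]
  refine Finset.prod_congr rfl fun i _ => ?_
  simp only [sub_comp, X_comp, C_comp, C_sub]
  ring

/-! ### Global analytic roots -/

/-- Equal multisets of values mean that corresponding fibres have equal cardinality; bijections
between the fibres assemble to a permutation. -/
theorem exists_perm_of_map_eq {α β : Type*} [Fintype α] {f g : α → β}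
    (h : Finset.univ.val.map f = Finset.univ.val.map g) : ∃ σ : Equiv.Perm α, ∀ i, f i = g (σ i) := by
  classical
  have hc : ∀ c, Nonempty ({a // f a = c} ≃ {a // g a = c}) := by
    intro c
    refine ⟨Fintype.equivOfCardEq ?_⟩
    have := congrArg (Multiset.count c) h
    rw [Multiset.count_map, Multiset.count_map] at this
    rw [Fintype.card_subtype, Fintype.card_subtype]
    simpa [eq_comm, Finset.card_def] using this
  exact ⟨Equiv.ofFiberEquiv fun c => (hc c).some, fun i => (Equiv.ofFiberEquiv_map _ i).symm⟩

theorem exists_perm_of_prod_eq {ι : Type*} [Fintype ι] {f g : ι → ℂ}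
    (h : ∏ i, (X - C (f i)) = ∏ i, (X - C (g i))) : ∃ σ : Equiv.Perm ι, ∀ i, f i = g (σ i) := by
  apply exists_perm_of_map_eq
  have h1 := congrArg roots h
  have key : ∀ f : ι → ℂ, (∏ i, (X - C (f i))).roots = Finset.univ.val.map f := by
    intro f
    rw [← roots_multiset_prod_X_sub_C (Finset.univ.val.map f), Multiset.map_map]
    rfl
  rwa [key, key] at h1

/-- Two analytic parametrizations of the roots agree up to a permutation. -/
theorem exists_perm_eventuallyEq {n : ℕ} {lam mu : Fin n → ℝ → ℂ} {t₀ : ℝ}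
    (hlam : ∀ i, AnalyticAt ℝ (lam i) t₀) (hmu : ∀ i, AnalyticAt ℝ (mu i) t₀)
    (h : ∀ᶠ t in 𝓝 t₀, ∏ i, (X - C (lam i t)) = ∏ i, (X - C (mu i t))) :
    ∃ σ : Equiv.Perm (Fin n), ∀ i, lam i =ᶠ[𝓝 t₀] mu (σ i) := by
  -- At each t some permutation matches the two lists. There are finitely many permutations, so one
  -- works for t accumulating at t₀, and the identity theorem makes it work near t₀.
  have h1 : ∃ σ : Equiv.Perm (Fin n), ∃ᶠ t in 𝓝[≠] t₀, ∀ i, lam i t = mu (σ i) t := by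
    by_contra! hcon
    have hne : ∀ᶠ t in 𝓝[≠] t₀, False := by
      filter_upwards [eventually_all.2 hcon, h.filter_mono nhdsWithin_le_nhds] with t h1 h2
      obtain ⟨σ, hσ⟩ := exists_perm_of_prod_eq h2
      obtain ⟨i, hi⟩ := h1 σ
      exact hi (hσ i)
    exact hne.exists.elim fun _ h => h
  obtain ⟨σ, hσ⟩ := h1
  exact ⟨σ, fun i => ((hlam i).frequently_eq_iff_eventually_eq (hmu (σ i))).1
    (hσ.mono fun t ht => ht i)⟩

/-- `lam` is an analytic parametrization of the roots of `P` near the set `s`. -/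
def IsAnalyticRootsOn (P : ℝ → ℂ[X]) {n : ℕ} (lam : Fin n → ℝ → ℂ) (s : Set ℝ) : Prop :=
  ∀ t ∈ s, (∀ i, AnalyticAt ℝ (lam i) t) ∧ ∀ᶠ r in 𝓝 t, P r = ∏ i, (X - C (lam i r))

theorem IsAnalyticRootsOn.glue {P : ℝ → ℂ[X]} {n : ℕ} {lam mu : Fin n → ℝ → ℂ} {a b c : ℝ}
    (hab : a ≤ b) (hbc : b ≤ c) (hlam : IsAnalyticRootsOn P lam (Set.Icc a b))
    (hmu : IsAnalyticRootsOn P mu (Set.Icc b c)) :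
    ∃ nu : Fin n → ℝ → ℂ, IsAnalyticRootsOn P nu (Set.Icc a c) := by
  obtain ⟨h1, h2⟩ := hlam b (Set.right_mem_Icc.2 hab)
  obtain ⟨h3, h4⟩ := hmu b (Set.left_mem_Icc.2 hbc)
  obtain ⟨σ, hσ⟩ := exists_perm_eventuallyEq h1 h3
    (by filter_upwards [h2, h4] with t e1 e2; rw [← e1, e2])
  -- Since `lam i` and `mu (σ i)` agree near b, switching from one to the other at b preserves
  -- analyticity.
  let nu : Fin n → ℝ → ℂ := fun i t => if t ≤ b then lam i t else mu (σ i) t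
  have hleft : ∀ t ∈ Set.Icc a b, ∀ i, nu i =ᶠ[𝓝 t] lam i := by
    intro t ht i
    rcases ht.2.lt_or_eq with h | rfl
    · filter_upwards [gt_mem_nhds h] with r hr
      exact if_pos hr.le
    · filter_upwards [hσ i] with r hr
      simp only [nu]
      split_ifs
      · rfl
      · exact hr.symm
  have hright : ∀ t ∈ Set.Ioc b c, ∀ i, nu i =ᶠ[𝓝 t] mu (σ i) := by
    intro t ht i
    filter_upwards [lt_mem_nhds ht.1] with r hr
    exact if_neg (not_le.2 hr)
  refine ⟨nu, fun t ht => ?_⟩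
  by_cases htb : t ≤ b
  · have ht' : t ∈ Set.Icc a b := ⟨ht.1, htb⟩
    refine ⟨fun i => ((hlam t ht').1 i).congr (hleft t ht' i).symm, ?_⟩
    filter_upwards [(hlam t ht').2, eventually_all.2 (hleft t ht')] with r e1 e2
    simp only [e1, e2]
  · have ht' : t ∈ Set.Ioc b c := ⟨not_le.1 htb, ht.2⟩
    have ht'' : t ∈ Set.Icc b c := ⟨ht'.1.le, ht'.2⟩
    refine ⟨fun i => ((hmu t ht'').1 (σ i)).congr (hright t ht' i).symm, ?_⟩
    filter_upwards [(hmu t ht'').2, eventually_all.2 (hright t ht')] with r e1 e2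
    simp only [e1, e2]
    exact (Equiv.prod_comp σ fun i => X - C (mu i r)).symm

/-- A family of polynomials with locally analytic roots has globally analytic roots on compact
intervals. -/
theorem exists_isAnalyticRootsOn_Icc {P : ℝ → ℂ[X]} {n : ℕ}
    (hP : ∀ t, HasAnalyticRootsAt P n t) {a b : ℝ} (hab : a ≤ b) :
    ∃ lam : Fin n → ℝ → ℂ, IsAnalyticRootsOn P lam (Set.Icc a b) := by
  choose loc hloc hP using hP
  have hopen : ∀ t : ℝ, ∃ U : Set ℝ, IsOpen U ∧ t ∈ U ∧ IsAnalyticRootsOn P (loc t) U := by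
    intro t
    have h1 : ∀ᶠ r in 𝓝 t, (∀ i, AnalyticAt ℝ (loc t i) r) ∧
        ∀ᶠ s in 𝓝 r, P s = ∏ i, (X - C (loc t i s)) :=
      (eventually_all.2 fun i => (hloc t i).eventually_analyticAt).and (hP t).eventually_nhds
    obtain ⟨U, h2, h3, h4⟩ := eventually_nhds_iff.1 h1
    exact ⟨U, h3, h4, h2⟩
  choose U hU htU hroots using hopen
  -- By compactness, a subdivision each of whose intervals lies in one neighbourhood `U r`; gluing
  -- proceeds from left to right.
  obtain ⟨t, ht0, hmono, ⟨m, hm⟩, hsub⟩ := exists_monotone_Icc_subset_open_cover_Icc hab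
    (c := fun r : ℝ => (Subtype.val ⁻¹' U r : Set (Set.Icc a b)))
    (fun r => (hU r).preimage continuous_subtype_val)
    (fun x _ => Set.mem_iUnion.2 ⟨x, htU x⟩)
  have hstep : ∀ k, ∃ lam : Fin n → ℝ → ℂ, IsAnalyticRootsOn P lam (Set.Icc (t k : ℝ) (t (k + 1))) := by
    intro k
    obtain ⟨r, hr⟩ := hsub k
    refine ⟨loc r, fun s hs => hroots r s ?_⟩
    exact hr (a := ⟨s, (t k).2.1.trans hs.1, hs.2.trans (t (k + 1)).2.2⟩) ⟨hs.1, hs.2⟩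
  have hind : ∀ k, ∃ lam : Fin n → ℝ → ℂ, IsAnalyticRootsOn P lam (Set.Icc a (t (k + 1))) := by
    intro k
    induction k with
    | zero =>
      obtain ⟨lam, h⟩ := hstep 0
      rw [ht0] at h
      exact ⟨lam, h⟩
    | succ k ih =>
      obtain ⟨lam, h1⟩ := ih
      obtain ⟨mu, h2⟩ := hstep (k + 1)
      exact h1.glue (t (k + 1)).2.1 (hmono (Nat.le_succ _)) h2
  obtain ⟨lam, h⟩ := hind m
  rw [hm (m + 1) (Nat.le_succ m)] at h
  exact ⟨lam, h⟩

/-! ### Eigenvalues of the symbol -/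

theorem isHermitian_symbol {N : ℕ} {A B : Matrix (Fin N) (Fin N) ℂ} (hB : B.IsHermitian) (p : ℝ) :
    (symbol A B p).IsHermitian := by
  unfold symbol Matrix.IsHermitian
  rw [Matrix.conjTranspose_add, Matrix.conjTranspose_add, Matrix.conjTranspose_smul,
    Matrix.conjTranspose_smul, Matrix.conjTranspose_conjTranspose, hB.eq]
  have h1 : star (Complex.exp (-(Complex.I * p))) = Complex.exp (Complex.I * p) := by
    change (starRingEnd ℂ) _ = _
    rw [← Complex.exp_conj]
    simp
  have h2 : star (Complex.exp (Complex.I * p)) = Complex.exp (-(Complex.I * p)) := by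
    rw [← h1, star_star]
  rw [h1, h2]
  abel

theorem analyticAt_symbol {N : ℕ} (A B : Matrix (Fin N) (Fin N) ℂ) (i j : Fin N) (p : ℝ) :
    AnalyticAt ℝ (fun p => symbol A B p i j) p := by
  have h : AnalyticAt ℝ (fun p : ℝ => Complex.I * (p : ℂ)) p :=
    analyticAt_const.mul (Complex.ofRealCLM.analyticAt p)
  have he : ∀ z : ℂ, AnalyticAt ℝ Complex.exp z := fun z =>
    (Complex.differentiable_exp.analyticAt z).restrictScalars
  change AnalyticAt ℝ (fun p : ℝ => Complex.exp (-(Complex.I * p)) * A i j +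
    Complex.exp (Complex.I * p) * A.conjTranspose i j + B i j) p
  exact ((((he _).comp_of_eq h.neg rfl).mul analyticAt_const).add
    (((he _).comp_of_eq h rfl).mul analyticAt_const)).add analyticAt_const

/-- A family of polynomials has coefficients analytic at `t₀`. -/
def AnalyticCoeffs (P : ℝ → ℂ[X]) (t₀ : ℝ) : Prop :=
  ∀ k, AnalyticAt ℝ (fun t => (P t).coeff k) t₀

theorem AnalyticCoeffs.mul {P Q : ℝ → ℂ[X]} {t₀ : ℝ} (hP : AnalyticCoeffs P t₀)
    (hQ : AnalyticCoeffs Q t₀) : AnalyticCoeffs (fun t => P t * Q t) t₀ := by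
  intro k
  simp only [coeff_mul]
  exact Finset.analyticAt_fun_sum _ fun j _ => (hP j.1).mul (hQ j.2)

theorem AnalyticCoeffs.sum {ι : Type*} (s : Finset ι) {P : ι → ℝ → ℂ[X]} {t₀ : ℝ}
    (hP : ∀ i ∈ s, AnalyticCoeffs (P i) t₀) : AnalyticCoeffs (fun t => ∑ i ∈ s, P i t) t₀ := by
  intro k
  simp only [finsetSum_coeff]
  exact Finset.analyticAt_fun_sum _ fun i hi => hP i hi k

theorem AnalyticCoeffs.const (p : ℂ[X]) (t₀ : ℝ) : AnalyticCoeffs (fun _ => p) t₀ :=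
  fun _ => analyticAt_const

theorem AnalyticCoeffs.prod {ι : Type*} (s : Finset ι) {P : ι → ℝ → ℂ[X]} {t₀ : ℝ}
    (hP : ∀ i ∈ s, AnalyticCoeffs (P i) t₀) : AnalyticCoeffs (fun t => ∏ i ∈ s, P i t) t₀ := by
  classical
  induction s using Finset.induction_on with
  | empty => simpa using AnalyticCoeffs.const 1 t₀
  | insert a s ha ih =>
    simp only [Finset.prod_insert ha]
    exact (hP a (Finset.mem_insert_self a s)).mul
      (ih fun i hi => hP i (Finset.mem_insert_of_mem hi))

theorem analyticCoeffs_charpoly {N : ℕ} {M : ℝ → Matrix (Fin N) (Fin N) ℂ} {t₀ : ℝ}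
    (hM : ∀ i j, AnalyticAt ℝ (fun t => M t i j) t₀) : AnalyticCoeffs (fun t => (M t).charpoly) t₀ := by
  simp only [Matrix.charpoly, Matrix.det_apply']
  refine AnalyticCoeffs.sum _ fun σ _ => (AnalyticCoeffs.const _ _).mul
    (AnalyticCoeffs.prod _ fun i _ k => ?_)
  simp only [Matrix.charmatrix_apply, coeff_sub, coeff_C]
  refine analyticAt_const.sub ?_
  split_ifs
  · exact hM _ _
  · exact analyticAt_const

/-- Analytic eigenvalues of the symbol. -/
theorem exists_analytic_eigenvalues {N : ℕ} (A B : Matrix (Fin N) (Fin N) ℂ) (hB : B.IsHermitian)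
    {a b : ℝ} (hab : a ≤ b) : ∃ lam : Fin N → ℝ → ℝ,
      (∀ j, AnalyticOnNhd ℝ (lam j) (Set.Icc a b)) ∧
      ∀ p ∈ Set.Icc a b, (symbol A B p).charpoly = ∏ j, (X - C (lam j p : ℂ)) := by
  have hreal : ∀ p, IsRealRooted (symbol A B p).charpoly := by
    intro p z hz
    rw [(isHermitian_symbol hB p).charpoly_eq, IsRoot, eval_prod, Finset.prod_eq_zero_iff] at hz
    obtain ⟨i, _, hi⟩ := hz
    rw [eval_sub, eval_X, eval_C, sub_eq_zero] at hi
    rw [hi]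
    exact Complex.ofReal_im _
  have hloc : ∀ p, HasAnalyticRootsAt (fun p => (symbol A B p).charpoly) N p := fun p =>
    hasAnalyticRootsAt_of_isRealRooted N ⟨fun t => Matrix.charpoly_monic _,
      fun t => by rw [Matrix.charpoly_natDegree_eq_dim, Fintype.card_fin],
      analyticCoeffs_charpoly fun i j => analyticAt_symbol A B i j p,
      Eventually.of_forall hreal⟩
  obtain ⟨lam, hlam⟩ := exists_isAnalyticRootsOn_Icc hloc hab
  refine ⟨fun j p => (lam j p).re, fun j p hp =>
    (Complex.reCLM.analyticAt _).comp ((hlam p hp).1 j), fun p hp => ?_⟩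
  have h : (symbol A B p).charpoly = ∏ j, (X - C (lam j p)) := (hlam p hp).2.self_of_nhds
  rw [h]
  refine Finset.prod_congr rfl fun j _ => ?_
  have : (lam j p).im = 0 := by
    refine hreal p _ ?_
    rw [h, IsRoot, eval_prod]
    exact Finset.prod_eq_zero (Finset.mem_univ j) (by simp)
  congr 2
  exact Complex.ext (Complex.ofReal_re _).symm (by simpa using this)

/-! ### Analytic kernel vectors -/

/-- The ring of functions on `s` which extend analytically to a neighbourhood of `s`. -/
def analyticSubring (s : Set ℝ) : Subring (s → ℂ) where
  carrier := {f | ∃ g : ℝ → ℂ, AnalyticOnNhd ℝ g s ∧ ∀ x : s, f x = g x}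
  mul_mem' := by
    rintro _ _ ⟨g₁, h₁, e₁⟩ ⟨g₂, h₂, e₂⟩
    exact ⟨fun x => g₁ x * g₂ x, h₁.mul h₂, fun x => by rw [Pi.mul_apply, e₁, e₂]⟩
  one_mem' := ⟨fun _ => 1, analyticOnNhd_const, fun _ => rfl⟩
  add_mem' := by
    rintro _ _ ⟨g₁, h₁, e₁⟩ ⟨g₂, h₂, e₂⟩
    exact ⟨fun x => g₁ x + g₂ x, h₁.add h₂, fun x => by rw [Pi.add_apply, e₁, e₂]⟩
  zero_mem' := ⟨fun _ => 0, analyticOnNhd_const, fun _ => rfl⟩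
  neg_mem' := by
    rintro _ ⟨g, h, e⟩
    exact ⟨fun x => -g x, h.neg, fun x => by rw [Pi.neg_apply, e]⟩

/-- By the identity theorem on a connected set, a product of analytic functions vanishes identically
only if a factor does. -/
theorem isDomain_analyticSubring {s : Set ℝ} (hs : IsPreconnected s) (hne : s.Nonempty) :
    IsDomain (analyticSubring s) := by
  have : NoZeroDivisors (analyticSubring s) := by
    refine ⟨?_⟩
    rintro ⟨f₁, g₁, h₁, e₁⟩ ⟨f₂, g₂, h₂, e₂⟩ h
    have h' : ∀ x ∈ s, g₁ x * g₂ x = 0 := fun x hx => by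
      have := congrFun (congrArg Subtype.val h) ⟨x, hx⟩
      rw [← e₁ ⟨x, hx⟩, ← e₂ ⟨x, hx⟩]
      exact this
    rcases h₁.eq_zero_or_eq_zero_of_mul_eq_zero h₂ h' hs with h | h
    · exact Or.inl (Subtype.ext (funext fun x => (e₁ x).trans (h x x.2)))
    · exact Or.inr (Subtype.ext (funext fun x => (e₂ x).trans (h x x.2)))
  have : Nontrivial (analyticSubring s) := by
    obtain ⟨x, hx⟩ := hne
    refine ⟨0, 1, fun h => ?_⟩
    have := congrFun (congrArg Subtype.val h) ⟨x, hx⟩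
    exact zero_ne_one this
  exact NoZeroDivisors.to_isDomain _

/-- A singular analytic family of matrices has a nonzero analytic kernel vector. -/
theorem exists_analytic_mulVec_eq_zero {ι : Type*} [Fintype ι] [DecidableEq ι] {s : Set ℝ}
    (hs : IsPreconnected s) (hne : s.Nonempty) {M : ℝ → Matrix ι ι ℂ}
    (hM : ∀ i j, AnalyticOnNhd ℝ (fun p => M p i j) s) (hdet : ∀ p ∈ s, (M p).det = 0) :
    ∃ v : ℝ → ι → ℂ, (∀ i, AnalyticOnNhd ℝ (fun p => v p i) s) ∧ (∃ p ∈ s, v p ≠ 0) ∧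
      ∀ p ∈ s, (M p).mulVec (v p) = 0 := by
  have := isDomain_analyticSubring hs hne
  let M' : Matrix ι ι (analyticSubring s) := fun i j => ⟨fun p => M p i j, _, hM i j, fun _ => rfl⟩
  let ev : s → analyticSubring s →+* ℂ := fun p =>
    (Pi.evalRingHom (fun _ : s => ℂ) p).comp (analyticSubring s).subtype
  have hev : ∀ p : s, (ev p).mapMatrix M' = M p := fun p => rfl
  have hdet' : M'.det = 0 := by
    refine Subtype.ext (funext fun p => ?_)
    change ev p M'.det = 0
    rw [RingHom.map_det, hev]
    exact hdet p p.2
  -- Linear algebra over the integral domain of analytic functions: pointwise zero determinant is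
  -- zero determinant in the ring, which yields a single analytic kernel vector.
  obtain ⟨v, hv0, hv⟩ := Matrix.exists_mulVec_eq_zero_iff.2 hdet'
  choose g hg hvg using fun i => (v i).2
  refine ⟨fun p i => g i p, hg, ?_, ?_⟩
  · by_contra! h
    refine hv0 (funext fun i => Subtype.ext (funext fun p => ?_))
    exact (hvg i p).trans (congrFun (h p p.2) i)
  · intro p hp
    funext i
    have := congrArg (ev ⟨p, hp⟩) (congrFun hv i)
    simp only [Matrix.mulVec, dotProduct, map_sum, map_mul, Pi.zero_apply, map_zero] at this ⊢
    rw [← this]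
    exact Finset.sum_congr rfl fun j _ => congrArg (M p i j * ·) (hvg j ⟨p, hp⟩).symm

/-- An analytic function on a compact connected set which is not identically zero has finitely many
zeros. -/
theorem finite_zeros {E : Type*} [NormedAddCommGroup E] [NormedSpace ℝ E] {f : ℝ → E} {s : Set ℝ}
    (hf : AnalyticOnNhd ℝ f s) (hs : IsPreconnected s) (hc : IsCompact s) (h0 : ∃ p ∈ s, f p ≠ 0) :
    {p | p ∈ s ∧ f p = 0}.Finite := by
  by_contra hinf
  obtain ⟨x, hx, hacc⟩ := Set.Infinite.exists_accPt_of_subset_isCompact hinf hc fun p hp => hp.1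
  obtain ⟨p, hp, hfp⟩ := h0
  refine hfp (hf.eqOn_zero_of_preconnected_of_frequently_eq_zero hs hx ?_ hp)
  exact (accPt_iff_frequently_nhdsNE.1 hacc).mono fun y hy => hy.2

/-- Division of an analytic function by its zeros. -/
theorem exists_eq_smul_ne_zero {E : Type*} [NormedAddCommGroup E] [NormedSpace ℝ E] {s : Set ℝ}
    (hs : IsPreconnected s) (hc : IsCompact s) {f : ℝ → E} (hf : AnalyticOnNhd ℝ f s)
    (h0 : ∃ p ∈ s, f p ≠ 0) :
    ∃ (q : ℝ → ℝ) (g : ℝ → E), AnalyticOnNhd ℝ q s ∧ AnalyticOnNhd ℝ g s ∧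
      (∀ p ∈ s, f p = q p • g p) ∧ ∀ p ∈ s, g p ≠ 0 := by
  induction hn : {p | p ∈ s ∧ f p = 0}.ncard using Nat.strong_induction_on generalizing f with
  | _ n ih =>
  have hfin := finite_zeros hf hs hc h0
  by_cases hz : ∀ p ∈ s, f p ≠ 0
  · exact ⟨fun _ => 1, f, analyticOnNhd_const, hf, fun p _ => (one_smul ℝ _).symm, hz⟩
  push Not at hz
  obtain ⟨z, hz, hfz⟩ := hz
  have hnz : ¬ ∀ᶠ p in 𝓝 z, f p = 0 := by
    intro h
    obtain ⟨p, hp, hfp⟩ := h0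
    exact hfp (hf.eqOn_zero_of_preconnected_of_eventuallyEq_zero hs hz h hp)
  obtain ⟨d, g, hg, hg0, hfg⟩ := (hf z hz).exists_eventuallyEq_pow_smul_nonzero_iff.2 hnz
  -- The function f with its zero at z divided out. Its zeros are those of f other than z, so the
  -- number of zeros drops.
  let w : ℝ → E := fun p => if p = z then g z else ((p - z) ^ d)⁻¹ • f p
  have hwg : w =ᶠ[𝓝 z] g := by
    filter_upwards [hfg] with p hp
    by_cases h : p = z
    · simp [w, h]
    · simp only [w, if_neg h, hp]
      rw [smul_smul, inv_mul_cancel₀ (pow_ne_zero _ (sub_ne_zero.2 h)), one_smul]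
  have hfw : ∀ p, f p = (p - z) ^ d • w p := by
    intro p
    by_cases h : p = z
    · subst h
      rw [hwg.self_of_nhds]
      exact hfg.self_of_nhds
    · simp only [w, if_neg h]
      rw [smul_smul, mul_inv_cancel₀ (pow_ne_zero _ (sub_ne_zero.2 h)), one_smul]
  have hw : AnalyticOnNhd ℝ w s := by
    intro p hp
    by_cases h : p = z
    · subst h
      exact hg.congr hwg.symm
    · have h1 : AnalyticAt ℝ (fun p => ((p - z) ^ d)⁻¹ • f p) p :=
        (((analyticAt_id.sub analyticAt_const).pow d).inv
          (pow_ne_zero _ (sub_ne_zero.2 h))).smul (hf p hp)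
      refine h1.congr ?_
      filter_upwards [isOpen_ne.mem_nhds h] with r hr
      exact (if_neg hr).symm
  have hw0 : ∃ p ∈ s, w p ≠ 0 := ⟨z, hz, by rw [hwg.self_of_nhds]; exact hg0⟩
  have hlt : {p | p ∈ s ∧ w p = 0}.ncard < n := by
    rw [← hn]
    refine Set.ncard_lt_ncard ⟨?_, ?_⟩ hfin
    · rintro p ⟨hp, h⟩
      exact ⟨hp, by rw [hfw, h, smul_zero]⟩
    · intro h
      have : w z = 0 := (h ⟨hz, hfz⟩).2
      rw [hwg.self_of_nhds] at this
      exact hg0 this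
  obtain ⟨q, u, hq, hu, hwq, hu0⟩ := ih _ hlt hw hw0 rfl
  refine ⟨fun p => (p - z) ^ d * q p, u,
    fun p hp => ((analyticAt_id.sub analyticAt_const).pow d).mul (hq p hp), hu, fun p hp => ?_, hu0⟩
  rw [hfw, hwq p hp, smul_smul]

open scoped ComplexOrder in
/-- An analytic family of matrices which is nowhere injective has an analytic family of normalized
kernel vectors. -/
theorem exists_analytic_unit_mulVec_eq_zero {m : Type*} [Fintype m] {N : ℕ} {s : Set ℝ}
    (hs : IsPreconnected s) (hc : IsCompact s) (hne : s.Nonempty) {M : ℝ → Matrix m (Fin N) ℂ}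
    (hM : ∀ i j, AnalyticOnNhd ℝ (fun p => M p i j) s)
    (hker : ∀ p ∈ s, ∃ v, v ≠ 0 ∧ (M p).mulVec v = 0) :
    ∃ v : ℝ → EuclideanSpace ℂ (Fin N), AnalyticOnNhd ℝ v s ∧
      ∀ p ∈ s, ‖v p‖ = 1 ∧ (M p).mulVec (v p) = 0 := by
  have hconj : ∀ i j, AnalyticOnNhd ℝ (fun p => star (M p i j)) s := fun i j p hp =>
    (Complex.conjCLE.analyticAt _).comp (hM i j p hp)
  -- M may be rectangular; M* M is square with the same kernel. It stays analytic because the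
  -- parameter is real and conjugation is real linear.
  obtain ⟨v, hv, hv0, hMv⟩ := exists_analytic_mulVec_eq_zero hs hne
    (M := fun p => (M p).conjTranspose * M p)
    (fun i j p hp => by
      simp only [Matrix.mul_apply, Matrix.conjTranspose_apply]
      exact Finset.analyticAt_fun_sum _ fun k _ => (hconj k i p hp).mul (hM k j p hp))
    (fun p hp => by
      obtain ⟨v, hv, h⟩ := hker p hp
      exact Matrix.exists_mulVec_eq_zero_iff.1
        ⟨v, hv, (Matrix.conjTranspose_mul_self_mulVec_eq_zero _ _).2 h⟩)
  simp only [Matrix.conjTranspose_mul_self_mulVec_eq_zero] at hMv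
  let f : ℝ → EuclideanSpace ℂ (Fin N) := fun p => WithLp.toLp 2 (v p)
  have hf : AnalyticOnNhd ℝ f s := fun p hp =>
    ((EuclideanSpace.equiv (Fin N) ℂ).symm.toContinuousLinearMap.restrictScalars ℝ).analyticAt _
      |>.comp_of_eq (AnalyticAt.pi fun i => hv i p hp) rfl
  obtain ⟨q, g, hq, hg, hfg, hg0⟩ := exists_eq_smul_ne_zero hs hc hf (by
    obtain ⟨p, hp, h⟩ := hv0
    exact ⟨p, hp, fun h' => h (congrArg WithLp.ofLp h')⟩)
  have hgi : ∀ i, AnalyticOnNhd ℝ (fun p => g p i) s := fun i p hp =>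
    ((EuclideanSpace.proj (𝕜 := ℂ) i).restrictScalars ℝ).analyticAt _ |>.comp (hg p hp)
  have hMg : ∀ p ∈ s, (M p).mulVec (g p) = 0 := by
    intro p hp
    funext i
    have hMgi : AnalyticOnNhd ℝ (fun p => (M p).mulVec (g p) i) s := fun p hp => by
      simp only [Matrix.mulVec, dotProduct]
      exact Finset.analyticAt_fun_sum _ fun j _ => (hM i j p hp).mul (hgi j p hp)
    have hprod : ∀ p ∈ s, q p • (M p).mulVec (g p) i = 0 := by
      intro p hp
      have h1 := congrFun (hMv p hp) i
      have h2 : v p = q p • WithLp.ofLp (g p) := congrArg WithLp.ofLp (hfg p hp)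
      rw [h2, Matrix.mulVec_smul] at h1
      exact h1
    -- At zeros of q the scalar cannot be cancelled pointwise. The identity theorem cancels it
    -- globally, since q ≡ 0 would give v ≡ 0.
    rcases hq.eq_zero_or_eq_zero_of_smul_eq_zero hMgi hprod hs with h | h
    · obtain ⟨r, hr, hvr⟩ := hv0
      refine absurd ?_ hvr
      have h2 : v r = q r • WithLp.ofLp (g r) := congrArg WithLp.ofLp (hfg r hr)
      rw [h2, h r hr, zero_smul]
    · exact h p hp
  refine ⟨fun p => ‖g p‖⁻¹ • g p, fun p hp => ?_, fun p hp => ⟨?_, ?_⟩⟩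
  · have h1 : AnalyticAt ℝ (fun p => ‖g p‖) p :=
      (((contDiffAt_norm ℂ (n := ω) (hg0 p hp)).analyticAt).comp (hg p hp))
    exact (h1.inv (norm_ne_zero_iff.2 (hg0 p hp))).smul (hg p hp)
  · rw [norm_smul, norm_inv, norm_norm, inv_mul_cancel₀ (norm_ne_zero_iff.2 (hg0 p hp))]
  · change (M p).mulVec (‖g p‖⁻¹ • WithLp.ofLp (g p)) = 0
    rw [Matrix.mulVec_smul, hMg p hp, smul_zero]

/-! ### Analytic eigenvectors -/

/-- The two factorizations of the characteristic polynomial list the same eigenvalues up to order,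
so the standard eigenbasis is reindexed. -/
theorem exists_orthonormalBasis_eigen {N : ℕ} {H : Matrix (Fin N) (Fin N) ℂ} (hH : H.IsHermitian)
    {mu : Fin N → ℝ} (hmu : H.charpoly = ∏ j, (X - C (mu j : ℂ))) :
    ∃ b : OrthonormalBasis (Fin N) ℂ (EuclideanSpace ℂ (Fin N)),
      ∀ j, Matrix.toEuclideanCLM (n := Fin N) (𝕜 := ℂ) H (b j) = (mu j : ℂ) • b j := by
  obtain ⟨σ, hσ⟩ := exists_perm_of_prod_eq (hmu.symm.trans hH.charpoly_eq)
  refine ⟨hH.eigenvectorBasis.reindex σ.symm, fun j => ?_⟩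
  have h := hH.mulVec_eigenvectorBasis (σ j)
  rw [OrthonormalBasis.reindex_apply, Equiv.symm_symm]
  refine WithLp.ofLp_injective 2 ?_
  rw [Matrix.ofLp_toEuclideanCLM, h, hσ j]
  rfl

theorem inner_toEuclideanCLM_comm {N : ℕ} {H : Matrix (Fin N) (Fin N) ℂ} (hH : H.IsHermitian)
    (v w : EuclideanSpace ℂ (Fin N)) :
    ⟪Matrix.toEuclideanCLM (n := Fin N) (𝕜 := ℂ) H v, w⟫_ℂ =
      ⟪v, Matrix.toEuclideanCLM (n := Fin N) (𝕜 := ℂ) H w⟫_ℂ := by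
  have h : star (Matrix.toEuclideanCLM (n := Fin N) (𝕜 := ℂ) H) =
      Matrix.toEuclideanCLM (n := Fin N) (𝕜 := ℂ) H := by
    rw [← map_star]
    exact congrArg _ hH
  conv_rhs => rw [← h, ContinuousLinearMap.star_eq_adjoint,
    ContinuousLinearMap.adjoint_inner_right]

/-- Given orthonormal eigenvectors for the eigenvalues with index `< k`, there is an eigenvector for
the `k`-th eigenvalue which is orthogonal to them. -/
theorem exists_eigenvector_orthogonal {N : ℕ} {H : Matrix (Fin N) (Fin N) ℂ} (hH : H.IsHermitian)
    {mu : Fin N → ℝ} (hmu : H.charpoly = ∏ j, (X - C (mu j : ℂ))) (k : Fin N)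
    (W : Fin N → EuclideanSpace ℂ (Fin N))
    (hW : ∀ i < k, Matrix.toEuclideanCLM (n := Fin N) (𝕜 := ℂ) H (W i) = (mu i : ℂ) • W i) :
    ∃ v ≠ 0, Matrix.toEuclideanCLM (n := Fin N) (𝕜 := ℂ) H v = (mu k : ℂ) • v ∧
      ∀ i < k, ⟪W i, v⟫_ℂ = 0 := by
  obtain ⟨b, hb⟩ := exists_orthonormalBasis_eigen hH hmu
  -- The eigenspace has dimension |S|. Orthogonality to the earlier `W i` in it imposes only |S'| <
  -- |S| conditions, as k lies in S but not in S'. The other `W i` are orthogonal automatically,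
  -- having different eigenvalues.
  let S := {j : Fin N // mu j = mu k}
  let S' := {j : S // j.1 < k}
  let comb : (S → ℂ) →ₗ[ℂ] EuclideanSpace ℂ (Fin N) :=
    Fintype.linearCombination ℂ fun j : S => b j
  let L : (S → ℂ) →ₗ[ℂ] (S' → ℂ) :=
    LinearMap.pi fun i => (innerSL ℂ (W i.1)).toLinearMap ∘ₗ comb
  have hcard : Module.finrank ℂ (S' → ℂ) < Module.finrank ℂ (S → ℂ) := by
    rw [Module.finrank_fintype_fun_eq_card, Module.finrank_fintype_fun_eq_card]
    exact Fintype.card_subtype_lt (x := (⟨k, rfl⟩ : S)) (lt_irrefl k)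
  obtain ⟨c, hc, hc0⟩ := (Submodule.ne_bot_iff _).1 (LinearMap.ker_ne_bot_of_finrank_lt (f := L) hcard)
  have hcomb : comb c = ∑ j : S, c j • b j := Fintype.linearCombination_apply ℂ _ c
  have hlin : LinearIndependent ℂ fun j : S => b j :=
    b.orthonormal.linearIndependent.comp (fun j : S => j.1) Subtype.val_injective
  have hv : Matrix.toEuclideanCLM (n := Fin N) (𝕜 := ℂ) H (comb c) = (mu k : ℂ) • comb c := by
    rw [hcomb, map_sum, Finset.smul_sum]
    refine Finset.sum_congr rfl fun j _ => ?_
    rw [map_smul, hb, j.2, smul_comm]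
  refine ⟨comb c, fun h => hc0 ?_, hv, fun i hi => ?_⟩
  · exact funext (Fintype.linearIndependent_iff.1 hlin c (hcomb ▸ h))
  · by_cases h : mu i = mu k
    · exact congrFun hc ⟨⟨i, h⟩, hi⟩
    · have h1 := inner_toEuclideanCLM_comm hH (W i) (comb c)
      rw [hv, hW i hi, inner_smul_left, inner_smul_right, Complex.conj_ofReal] at h1
      have h2 : ((mu i : ℂ) - mu k) * ⟪W i, comb c⟫_ℂ = 0 := by linear_combination h1
      refine (mul_eq_zero.1 h2).resolve_left ?_
      refine sub_ne_zero.2 ?_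
      exact_mod_cast h

/-- Analytic eigenvalues have analytic orthonormal eigenvectors. -/
theorem exists_analytic_eigenvectors {N : ℕ} {H : ℝ → Matrix (Fin N) (Fin N) ℂ} {s : Set ℝ}
    (hs : IsPreconnected s) (hc : IsCompact s) (hne : s.Nonempty)
    (hH : ∀ p ∈ s, (H p).IsHermitian) (hHa : ∀ i j, AnalyticOnNhd ℝ (fun p => H p i j) s)
    {lam : Fin N → ℝ → ℝ} (hlam : ∀ j, AnalyticOnNhd ℝ (lam j) s)
    (hchar : ∀ p ∈ s, (H p).charpoly = ∏ j, (X - C (lam j p : ℂ))) (k : ℕ) (hk : k ≤ N) :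
    ∃ W : Fin N → ℝ → EuclideanSpace ℂ (Fin N),
      (∀ j : Fin N, j.1 < k → AnalyticOnNhd ℝ (W j) s) ∧
      ∀ p ∈ s, (∀ j : Fin N, j.1 < k → ‖W j p‖ = 1 ∧
        Matrix.toEuclideanCLM (n := Fin N) (𝕜 := ℂ) (H p) (W j p) = (lam j p : ℂ) • W j p) ∧
        ∀ i j : Fin N, i.1 < k → j.1 < k → i ≠ j → ⟪W i p, W j p⟫_ℂ = 0 := by
  induction k with
  | zero => exact ⟨fun _ _ => 0, by simp, by simp⟩
  | succ k ih =>
    obtain ⟨W, hWa, hW⟩ := ih (by omega)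
    let κ : Fin N := ⟨k, by omega⟩
    -- The kernel consists of the λ_k-eigenvectors orthogonal to `W i` for i < k; rows with index at
    -- least k are padded by zero.
    let M : ℝ → Matrix (Fin N ⊕ Fin N) (Fin N) ℂ := fun p =>
      Matrix.fromRows (H p - Matrix.scalar (Fin N) (lam κ p : ℂ))
        (Matrix.of fun i j => if i.1 < k then star (W i p j) else 0)
    have hMv : ∀ p (v : EuclideanSpace ℂ (Fin N)), (M p).mulVec v = 0 ↔
        Matrix.toEuclideanCLM (n := Fin N) (𝕜 := ℂ) (H p) v = (lam κ p : ℂ) • v ∧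
          ∀ i : Fin N, i.1 < k → ⟪W i p, v⟫_ℂ = 0 := by
      intro p v
      rw [Matrix.fromRows_mulVec, Matrix.sub_mulVec]
      have h1 : Matrix.mulVec (Matrix.scalar (Fin N) (lam κ p : ℂ)) (v : Fin N → ℂ) =
          (lam κ p : ℂ) • (v : Fin N → ℂ) := by
        ext i
        simp [Matrix.scalar_apply, Matrix.mulVec_diagonal]
      have h2 : ∀ i : Fin N, i.1 < k → Matrix.mulVec
          (Matrix.of fun i j => if i.1 < k then star (W i p j) else 0) v i = ⟪W i p, v⟫_ℂ := by
        intro i hi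
        rw [EuclideanSpace.inner_eq_star_dotProduct, dotProduct_comm]
        simp [Matrix.mulVec, dotProduct, hi]
      have h3 : ∀ i : Fin N, ¬ i.1 < k → Matrix.mulVec
          (Matrix.of fun i j => if i.1 < k then star (W i p j) else 0) v i = 0 := by
        intro i hi
        simp [Matrix.mulVec, dotProduct, hi]
      rw [h1]
      constructor
      · intro h
        refine ⟨WithLp.ofLp_injective 2 ?_, fun i hi => ?_⟩
        · rw [Matrix.ofLp_toEuclideanCLM]
          funext i
          exact sub_eq_zero.1 (congrFun h (Sum.inl i))
        · rw [← h2 i hi]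
          exact congrFun h (Sum.inr i)
      · rintro ⟨h, h'⟩
        funext i
        rcases i with i | i
        · exact sub_eq_zero.2 (congrFun (congrArg WithLp.ofLp h) i)
        · by_cases hi : i.1 < k
          · exact (h2 i hi).trans (h' i hi)
          · exact h3 i hi
    have hMa : ∀ i j, AnalyticOnNhd ℝ (fun p => M p i j) s := by
      rintro (i | i) j p hp
      · change AnalyticAt ℝ (fun p => H p i j - Matrix.scalar (Fin N) (lam κ p : ℂ) i j) p
        refine (hHa i j p hp).sub ?_
        simp only [Matrix.scalar_apply, Matrix.diagonal_apply]
        split_ifs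
        · exact (Complex.ofRealCLM.analyticAt _).comp (hlam κ p hp)
        · exact analyticAt_const
      · change AnalyticAt ℝ (fun p => if i.1 < k then star (W i p j) else 0) p
        split_ifs with hi
        · exact (Complex.conjCLE.analyticAt _).comp
            (((EuclideanSpace.proj (𝕜 := ℂ) j).restrictScalars ℝ).analyticAt _ |>.comp (hWa i hi p hp))
        · exact analyticAt_const
    obtain ⟨v, hva, hv⟩ := exists_analytic_unit_mulVec_eq_zero hs hc hne hMa fun p hp => by
      obtain ⟨v, hv0, hv1, hv2⟩ := exists_eigenvector_orthogonal (hH p hp) (hchar p hp) κ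
        (fun i => W i p) fun i hi => ((hW p hp).1 i hi).2
      exact ⟨v, fun h => hv0 (WithLp.ofLp_injective 2 h), (hMv p v).2 ⟨hv1, fun i hi => hv2 i hi⟩⟩
    have hne' : ∀ j : Fin N, j.1 < k → j ≠ κ := fun j hj h => by
      rw [h] at hj
      exact lt_irrefl k hj
    have hcases : ∀ j : Fin N, j.1 < k + 1 → j = κ ∨ j.1 < k := fun j hj => by
      rcases Nat.lt_succ_iff_lt_or_eq.1 hj with h | h
      · exact Or.inr h
      · exact Or.inl (Fin.ext h)
    have hup : ∀ j : Fin N, j.1 < k → Function.update W κ v j = W j := fun j hj =>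
      Function.update_of_ne (hne' j hj) _ _
    have hupκ : Function.update W κ v κ = v := Function.update_self _ _ _
    refine ⟨Function.update W κ v, fun j hj => ?_, fun p hp => ⟨fun j hj => ?_, ?_⟩⟩
    · rcases hcases j hj with rfl | h
      · rwa [hupκ]
      · rw [hup j h]
        exact hWa j h
    · rcases hcases j hj with rfl | h
      · rw [hupκ]
        exact ⟨(hv p hp).1, ((hMv p _).1 (hv p hp).2).1⟩
      · rw [hup j h]
        exact (hW p hp).1 j h
    · intro i j hi hj hij
      have horth := ((hMv p _).1 (hv p hp).2).2
      rcases hcases i hi with rfl | h <;> rcases hcases j hj with rfl | h'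
      · exact absurd rfl hij
      · rw [hupκ, hup j h', inner_eq_zero_symm]
        exact horth j h'
      · rw [hupκ, hup i h]
        exact horth i h
      · rw [hup i h, hup j h']
        exact (hW p hp).2 i j h h' hij

theorem exists_isAnalyticEigenbasis {N : ℕ} (A B : Matrix (Fin N) (Fin N) ℂ)
    (hB : B.IsHermitian) : ∃ (lam : Fin N → ℝ → ℝ) (W : Fin N → ℝ → EuclideanSpace ℂ (Fin N)),
      IsAnalyticEigenbasis A B lam W := by
  have hπ : -Real.pi ≤ Real.pi := by linarith [Real.pi_pos]
  obtain ⟨lam, hlam, hchar⟩ := exists_analytic_eigenvalues A B hB hπ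
  obtain ⟨W, hWa, hW⟩ := exists_analytic_eigenvectors isPreconnected_Icc isCompact_Icc
    (Set.nonempty_Icc.2 hπ) (fun p _ => isHermitian_symbol hB p)
    (fun i j p _ => analyticAt_symbol A B i j p) hlam hchar N le_rfl
  exact ⟨lam, W, hlam, fun j => hWa j j.2,
    fun p hp => ⟨fun j => ((hW p hp).1 j j.2).1, fun i j hij => (hW p hp).2 i j i.2 j.2 hij⟩,
    fun p hp j => ((hW p hp).1 j j.2).2⟩

end BlockJacobi

namespace BlockJacobi

/-! ### Part (b): spectral measures and the spectrum of the free operator. -/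

open Filter Topology

/-! ### Spectral measures -/

section SpectralMeasure

variable {H : Type*} [NormedAddCommGroup H] [InnerProductSpace ℂ H] [CompleteSpace H]

/-- If `f` and `g` are `ε`-close on the spectrum, so are the quadratic forms of `f(T)` and
`g(T)`. -/
theorem abs_inner_cfc_sub_le {T : H →L[ℂ] H} (ψ : H) {f g : ℝ → ℝ}
    (hf : Continuous f) (hg : Continuous g) {ε : ℝ} (hε : 0 ≤ ε)
    (h : ∀ x ∈ spectrum ℝ T, |f x - g x| ≤ ε) :
    |(⟪ψ, cfc f T ψ⟫_ℂ).re - (⟪ψ, cfc g T ψ⟫_ℂ).re| ≤ ε * ‖ψ‖ ^ 2 := by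
  have h1 : ‖cfc f T - cfc g T‖ ≤ ε := by
    rw [← cfc_sub f g T hf.continuousOn hg.continuousOn]
    exact norm_cfc_le hε h
  rw [← Complex.sub_re, ← inner_sub_right, ← sub_apply]
  calc |(⟪ψ, (cfc f T - cfc g T) ψ⟫_ℂ).re| ≤ ‖⟪ψ, (cfc f T - cfc g T) ψ⟫_ℂ‖ := Complex.abs_re_le_norm _
    _ ≤ ‖ψ‖ * ‖(cfc f T - cfc g T) ψ‖ := norm_inner_le_norm _ _
    _ ≤ ‖ψ‖ * (ε * ‖ψ‖) := by
      gcongr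
      exact (ContinuousLinearMap.le_opNorm _ _).trans (by gcongr)
    _ = ε * ‖ψ‖ ^ 2 := by ring

theorem integral_polynomial_eq {T : H →L[ℂ] H} (hT : IsSelfAdjoint T) {ψ : H} {μ : Measure ℝ}
    (hint : ∀ k : ℕ, Integrable (fun x => x ^ k) μ)
    (h : ∀ k : ℕ, ∫ x, x ^ k ∂μ = (⟪ψ, (T ^ k) ψ⟫_ℂ).re) (q : Polynomial ℝ) :
    Integrable (fun x => q.eval x) μ ∧ ∫ x, q.eval x ∂μ = (⟪ψ, cfc q.eval T ψ⟫_ℂ).re := by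
  rw [cfc_polynomial q T hT]
  induction q using Polynomial.induction_on' with
  | add p q hp hq =>
    simp only [Polynomial.eval_add]
    refine ⟨hp.1.add hq.1, ?_⟩
    rw [integral_add hp.1 hq.1, hp.2, hq.2, map_add, add_apply,
      inner_add_right, Complex.add_re]
  | monomial n a =>
    simp only [Polynomial.eval_monomial, Polynomial.aeval_monomial]
    refine ⟨(hint n).const_mul a, ?_⟩
    rw [integral_const_mul, h, ← Algebra.smul_def, smul_apply, ← Complex.coe_smul,
      inner_smul_right, Complex.re_ofReal_mul]

/-- A compactly supported finite measure whose moments are those of the spectral measure is the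
spectral measure. -/
theorem spectralMeasure_eq_of_moments {T : H →L[ℂ] H} (hT : IsSelfAdjoint T) (ψ : H)
    (μ : Measure ℝ) [IsFiniteMeasure μ] {R : ℝ} (hμ : ∀ᵐ x ∂μ, x ∈ Set.Icc (-R) R)
    (h : ∀ k : ℕ, ∫ x, x ^ k ∂μ = (⟪ψ, (T ^ k) ψ⟫_ℂ).re) : spectralMeasure T ψ = μ := by
  refine Measure.ext_of_integral_eq_on_compactlySupported fun f => ?_
  rw [integral_spectralMeasure]
  -- One interval containing both the spectrum and the support of μ, so that a single Weierstrass
  -- approximation serves both sides.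
  set R' := max R ‖T‖ with hR'
  have hμ' : ∀ᵐ x ∂μ, x ∈ Set.Icc (-R') R' := hμ.mono fun x hx =>
    ⟨(neg_le_neg (le_max_left _ _)).trans hx.1, hx.2.trans (le_max_left _ _)⟩
  have hspec : ∀ x ∈ spectrum ℝ T, x ∈ Set.Icc (-R') R' := fun x hx => by
    have h1 : |x| ≤ ‖T‖ * ‖(1 : H →L[ℂ] H)‖ := spectrum.norm_le_norm_mul_of_mem hx
    have h2 : ‖(1 : H →L[ℂ] H)‖ ≤ 1 := ContinuousLinearMap.norm_id_le
    exact abs_le.1 (h1.trans ((mul_le_of_le_one_right (norm_nonneg _) h2).trans (le_max_right _ _)))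
  have hint : ∀ k : ℕ, Integrable (fun x : ℝ => x ^ k) μ := fun k => by
    refine Integrable.of_bound (by fun_prop) (R' ^ k) (hμ'.mono fun x hx => ?_)
    rw [norm_pow, Real.norm_eq_abs]
    exact pow_le_pow_left₀ (abs_nonneg x) (abs_le.2 hx) k
  have hfint : Integrable (fun x => f x) μ :=
    f.continuous.integrable_of_hasCompactSupport f.hasCompactSupport
  refine eq_of_abs_sub_le_all fun ε hε => ?_
  -- The two approximation errors add up to (ε / c)(c - 1); the summand 1 keeps c positive.
  set c := ‖ψ‖ ^ 2 + μ.real Set.univ + 1 with hc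
  have hc0 : 0 < c := by positivity
  obtain ⟨q, hq⟩ := exists_polynomial_near_of_continuousOn (-R') R' f f.continuous.continuousOn
    (ε / c) (by positivity)
  obtain ⟨hqi, hqe⟩ := integral_polynomial_eq hT hint h q
  have h1 := abs_inner_cfc_sub_le (T := T) ψ (f := fun x => f x) (g := fun x => q.eval x)
    f.continuous q.continuous (ε := ε / c) (by positivity)
    fun x hx => by rw [abs_sub_comm]; exact (hq x (hspec x hx)).le
  have h2 : |(∫ x, q.eval x ∂μ) - ∫ x, f x ∂μ| ≤ ε / c * μ.real Set.univ := by
    rw [← integral_sub hqi hfint]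
    exact norm_integral_le_of_norm_le_const (f := fun x => q.eval x - f x)
      (hμ'.mono fun x hx => (hq x hx).le)
  rw [hqe] at h2
  calc _ ≤ _ := abs_sub_le _ (⟪ψ, cfc (fun x => q.eval x) T ψ⟫_ℂ).re _
    _ ≤ ε / c * ‖ψ‖ ^ 2 + ε / c * μ.real Set.univ := add_le_add h1 h2
    _ = ε / c * (c - 1) := by rw [hc]; ring
    _ ≤ ε / c * c := by gcongr; linarith
    _ = ε := by field_simp

/-- A cutoff function which is `1` on a compact set and on the spectrum. -/
theorem exists_cutoff {T : H →L[ℂ] H} (hT : IsSelfAdjoint T) {K : Set ℝ} (hK : IsCompact K) :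
    ∃ f : C_c(ℝ, ℝ), (∀ x, 0 ≤ f x) ∧ (∀ x ∈ K, f x = 1) ∧ cfc (fun x => f x) T = 1 := by
  obtain ⟨f, hf1, -, hfc, hf⟩ := exists_continuous_one_zero_of_isCompact
    (hK.union (spectrum.isCompact (𝕜 := ℝ) T)) isClosed_empty (Set.disjoint_empty _)
  refine ⟨⟨f, hfc⟩, fun x => (hf x).1, fun x hx => hf1 (Or.inl hx), ?_⟩
  rw [← cfc_const_one ℝ T]
  exact cfc_congr fun x hx => hf1 (Or.inr hx)

/-- Inner regularity reduces to compact K. A cutoff equal to 1 on K and on the spectrum has f(T) =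
1, so it integrates to ‖ψ‖². -/
theorem spectralMeasure_univ_le {T : H →L[ℂ] H} (hT : IsSelfAdjoint T) (ψ : H) :
    spectralMeasure T ψ Set.univ ≤ ENNReal.ofReal (‖ψ‖ ^ 2) := by
  rw [isOpen_univ.measure_eq_iSup_isCompact]
  refine iSup₂_le fun K _ => iSup_le fun hK => ?_
  obtain ⟨f, hf0, hf1, hf⟩ := exists_cutoff hT hK
  refine (RealRMK.rieszMeasure_le_of_eq_one (spectralFunctional T ψ) hf0 hK hf1).trans (le_of_eq ?_)
  change ENNReal.ofReal (⟪ψ, cfc (fun x => f x) T ψ⟫_ℂ).re = _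
  rw [hf, ← inner_self_eq_norm_sq (𝕜 := ℂ)]
  rfl

theorem eq_zero_of_spectralMeasure_eq_zero {T : H →L[ℂ] H} (hT : IsSelfAdjoint T) {ψ : H}
    (h : spectralMeasure T ψ = 0) : ψ = 0 := by
  obtain ⟨f, -, -, hf⟩ := exists_cutoff hT isCompact_empty
  have h1 := integral_spectralMeasure T ψ f
  rw [h, integral_zero_measure, hf] at h1
  have h2 : ‖ψ‖ ^ 2 = 0 := by
    rw [← inner_self_eq_norm_sq (𝕜 := ℂ)]
    exact h1.symm
  exact norm_eq_zero.1 (pow_eq_zero_iff two_ne_zero |>.1 h2)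

/-- The parallelogram law with the measure at φ - ψ dropped. -/
theorem spectralMeasure_add_le (T : H →L[ℂ] H) (φ ψ : H) (S : Set ℝ) :
    spectralMeasure T (φ + ψ) S ≤ 2 * (spectralMeasure T φ S + spectralMeasure T ψ S) := by
  have h := congrArg (fun μ : Measure ℝ => μ S) (spectralMeasure_add_add_sub T φ ψ)
  simp only [Measure.add_apply, Measure.smul_apply] at h
  refine le_self_add.trans (h.le.trans (le_of_eq ?_))
  rw [ENNReal.smul_def, smul_eq_mul]
  rfl

/-- The closed subspace of all vectors whose spectral measure vanishes on `S`. -/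
def nullSubspace (T : H →L[ℂ] H) (S : Set ℝ) : Submodule ℂ H where
  carrier := {ψ | spectralMeasure T ψ S = 0}
  zero_mem' := by simp [spectralMeasure_zero]
  add_mem' := by
    intro φ ψ hφ hψ
    have h := spectralMeasure_add_le T φ ψ S
    rw [Set.mem_ofPred_eq] at hφ hψ ⊢
    rw [hφ, hψ, add_zero, mul_zero] at h
    exact le_antisymm h zero_le
  smul_mem' := by
    intro c ψ hψ
    rw [Set.mem_ofPred_eq] at hψ ⊢
    rw [spectralMeasure_smul, Measure.smul_apply, hψ, smul_zero]

theorem isClosed_nullSubspace {T : H →L[ℂ] H} (hT : IsSelfAdjoint T) (S : Set ℝ) :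
    IsClosed (nullSubspace T S : Set H) := by
  rw [isClosed_iff_clusterPt]
  intro ψ hψ
  have hψ' : ψ ∈ closure (nullSubspace T S : Set H) := mem_closure_iff_clusterPt.2 hψ
  change spectralMeasure T ψ S = 0
  refine le_antisymm (ENNReal.le_of_forall_pos_le_add fun ε hε _ => ?_) zero_le
  -- The mass at ψ - φ is at most ‖ψ - φ‖² < ε / 2, and `spectralMeasure_add_le` costs a factor 2.
  obtain ⟨φ, hφ, hd⟩ := Metric.mem_closure_iff.1 hψ' (Real.sqrt (ε / 2))
    (Real.sqrt_pos.2 (by positivity))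
  have hφ0 : spectralMeasure T φ S = 0 := hφ
  have h1 := spectralMeasure_add_le T φ (ψ - φ) S
  rw [add_sub_cancel, hφ0, zero_add] at h1
  refine h1.trans ?_
  rw [zero_add]
  calc 2 * spectralMeasure T (ψ - φ) S ≤ 2 * ENNReal.ofReal (‖ψ - φ‖ ^ 2) := by
        gcongr
        exact (measure_mono (Set.subset_univ _)).trans (spectralMeasure_univ_le hT _)
    _ ≤ 2 * ENNReal.ofReal (ε / 2) := by
        gcongr
        rw [dist_eq_norm] at hd
        exact ((Real.lt_sqrt (norm_nonneg _)).1 hd).le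
    _ = ε := by
        rw [← ENNReal.ofReal_ofNat 2, ← ENNReal.ofReal_mul (by norm_num), mul_div_cancel₀ _ (two_ne_zero' ℝ)]
        exact ENNReal.ofReal_coe_nnreal

/-- Both sides have k-th moment x^k ‖ψ‖². -/
theorem spectralMeasure_of_eigenvector {T : H →L[ℂ] H} (hT : IsSelfAdjoint T) {ψ : H} {x : ℝ}
    (h : T ψ = (x : ℂ) • ψ) :
    spectralMeasure T ψ = ENNReal.ofReal (‖ψ‖ ^ 2) • Measure.dirac x := by
  have hpow : ∀ k : ℕ, (T ^ k) ψ = ((x ^ k : ℝ) : ℂ) • ψ := by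
    intro k
    induction k with
    | zero => simp
    | succ k ih =>
      rw [pow_succ, mul_apply_eq_comp, h, map_smul, ih, smul_smul]
      push_cast
      ring_nf
  have : IsFiniteMeasure (ENNReal.ofReal (‖ψ‖ ^ 2) • Measure.dirac x) :=
    Measure.smul_finite _ ENNReal.ofReal_ne_top
  refine spectralMeasure_eq_of_moments hT ψ _ (R := |x|) ?_ fun k => ?_
  · refine Measure.ae_smul_measure ?_ _
    rw [ae_dirac_eq]
    exact abs_le.1 le_rfl
  · rw [integral_smul_measure, integral_dirac, hpow, inner_smul_right, Complex.re_ofReal_mul,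
      ENNReal.toReal_ofReal (by positivity), smul_eq_mul, mul_comm,
      ← inner_self_eq_norm_sq (𝕜 := ℂ)]
    rfl

/-- A function which vanishes almost everywhere for all spectral measures vanishes on the
spectrum. -/
theorem cfc_eq_zero_of_ae {T : H →L[ℂ] H} {g : C(ℝ, ℝ)} (hgc : HasCompactSupport g)
    (h : ∀ ψ, ∀ᵐ x ∂(spectralMeasure T ψ), g x = 0) : cfc (fun x => g x) T = 0 := by
  refine ContinuousLinearMap.ext fun ψ => ?_
  -- The square is used because ⟨ψ, g(T)² ψ⟩ = ‖g(T) ψ‖².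
  let g2 : C_c(ℝ, ℝ) := ⟨g * g, hgc.mul_left⟩
  have h1 := integral_spectralMeasure T ψ g2
  have h2 : ∀ᵐ x ∂(spectralMeasure T ψ), g2 x = 0 := (h ψ).mono fun x hx => by
    change g x * g x = 0
    rw [hx, zero_mul]
  have h3 : cfc (fun x => g2 x) T = cfc (fun x => g x) T * cfc (fun x => g x) T :=
    cfc_mul (fun x => g x) (fun x => g x) T g.continuous.continuousOn g.continuous.continuousOn
  have h4 : IsSelfAdjoint (cfc (fun x => g x) T) := cfc_predicate _ _
  rw [integral_congr_ae h2, integral_zero, h3, mul_apply_eq_comp] at h1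
  have h5 : ⟪cfc (fun x => g x) T ψ, cfc (fun x => g x) T ψ⟫_ℂ =
      ⟪ψ, cfc (fun x => g x) T (cfc (fun x => g x) T ψ)⟫_ℂ :=
    ContinuousLinearMap.isSelfAdjoint_iff_isSymmetric.1 h4 ψ _
  rw [← h5] at h1
  have h6 : ‖cfc (fun x => g x) T ψ‖ ^ 2 = 0 := by
    rw [← inner_self_eq_norm_sq (𝕜 := ℂ)]
    exact h1.symm
  exact norm_eq_zero.1 (pow_eq_zero_iff two_ne_zero |>.1 h6)

/-- A bump g at a spectral point outside s, vanishing on s, would satisfy g(T) = 0 and hence vanish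
on the spectrum. -/
theorem spectrum_subset_of_spectralMeasure_compl {T : H →L[ℂ] H} (hT : IsSelfAdjoint T)
    {s : Set ℝ} (hs : IsClosed s) (h : ∀ ψ, spectralMeasure T ψ sᶜ = 0) :
    spectrum ℂ T ⊆ Complex.ofReal '' s := by
  rw [← hT.spectrumRestricts.algebraMap_image]
  refine Set.image_mono fun x hx => ?_
  by_contra hxs
  obtain ⟨g, hg1, hg0, hgc, -⟩ := exists_continuous_one_zero_of_isCompact isCompact_singleton
    hs (Set.disjoint_singleton_left.2 hxs)
  have hzero := cfc_eq_zero_of_ae hgc fun ψ =>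
    measure_mono_null (fun x hx hx' => hx (hg0 hx')) (h ψ)
  rw [← cfc_const_zero ℝ T] at hzero
  have h1 := (cfc_eq_cfc_iff_eqOn (ha := hT) g.continuous.continuousOn continuousOn_const).1 hzero hx
  have h2 : g x = 1 := hg1 rfl
  exact one_ne_zero (h2.symm.trans h1)

/-- Near a point of the resolvent set there is a test function which all spectral measures
annihilate. -/
theorem exists_integral_spectralMeasure_eq_zero {T : H →L[ℂ] H} (hT : IsSelfAdjoint T) {x : ℝ}
    (hx : (x : ℂ) ∉ spectrum ℂ T) : ∃ g : C(ℝ, ℝ), HasCompactSupport g ∧ (∀ y, 0 ≤ g y) ∧ g x = 1 ∧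
      ∀ ψ, ∫ y, g y ∂(spectralMeasure T ψ) = 0 := by
  have hxs : x ∉ spectrum ℝ T := fun h => hx (by
    rw [← hT.spectrumRestricts.algebraMap_image]
    exact ⟨x, h, rfl⟩)
  obtain ⟨g, hg1, hg0, hgc, hg⟩ := exists_continuous_one_zero_of_isCompact isCompact_singleton
    (spectrum.isCompact (𝕜 := ℝ) T).isClosed (Set.disjoint_singleton_left.2 hxs)
  refine ⟨g, hgc, fun y => (hg y).1, hg1 rfl, fun ψ => ?_⟩
  have hzero : cfc (fun x => g x) T = 0 := by
    rw [← cfc_const_zero ℝ T]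
    exact cfc_congr hg0
  refine (integral_spectralMeasure T ψ ⟨g, hgc⟩).trans ?_
  change (⟪ψ, cfc (fun x => g x) T ψ⟫_ℂ).re = 0
  rw [hzero, zero_apply, inner_zero_right, Complex.zero_re]

end SpectralMeasure

/-! ### Moments of the spectral measures at finitely supported vectors -/

section Moments

variable {N : ℕ}

/-- The symbol as an operator on `ℂᴺ`. -/
noncomputable def symbolOp (A B : Matrix (Fin N) (Fin N) ℂ) (p : ℝ) :
    EuclideanSpace ℂ (Fin N) →L[ℂ] EuclideanSpace ℂ (Fin N) :=
  Matrix.toEuclideanCLM (n := Fin N) (𝕜 := ℂ) (symbol A B p)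

theorem symbolOp_eq (A B : Matrix (Fin N) (Fin N) ℂ) (p : ℝ) : symbolOp A B p =
    Complex.exp (-(Complex.I * p)) • Matrix.toEuclideanCLM (n := Fin N) (𝕜 := ℂ) A +
      Complex.exp (Complex.I * p) • Matrix.toEuclideanCLM (n := Fin N) (𝕜 := ℂ) A.conjTranspose +
        Matrix.toEuclideanCLM (n := Fin N) (𝕜 := ℂ) B := by
  rw [symbolOp, symbol, map_add, map_add, map_smul, map_smul]

theorem continuous_symbolOp (A B : Matrix (Fin N) (Fin N) ℂ) : Continuous (symbolOp A B) := by
  simp only [funext (symbolOp_eq A B)]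
  fun_prop

/-- The Fourier character `p ↦ exp (-i d p)`. -/
noncomputable def character (d : ℤ) (p : ℝ) : ℂ := Complex.exp (-(Complex.I * d * p))

theorem continuous_character (d : ℤ) : Continuous (character d) := by
  unfold character
  fun_prop

theorem integral_character (d : ℤ) :
    ∫ p in -Real.pi..Real.pi, character d p = if d = 0 then (2 * Real.pi : ℂ) else 0 := by
  split_ifs with hd
  · subst hd
    simp only [character, Int.cast_zero, mul_zero, zero_mul, neg_zero, Complex.exp_zero,
      intervalIntegral.integral_const]
    rw [Complex.real_smul]
    push_cast
    ring
  · have hc : -(Complex.I * d) ≠ 0 := by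
      simpa using hd
    have h1 : ∀ p : ℝ, character d p = Complex.exp (-(Complex.I * d) * p) := fun p => by
      rw [character, neg_mul]
    simp only [h1]
    rw [integral_exp_mul_complex hc, div_eq_zero_iff]
    left
    rw [sub_eq_zero, Complex.exp_eq_exp_iff_exists_int]
    refine ⟨-d, ?_⟩
    push_cast
    ring

/-- The Fourier picture without the Fourier transform: under the integral, a shift of the site
multiplies the character by e^{±ip}, so each application of H₀ becomes one of h(p). The case k = 0
is orthogonality of characters. -/
theorem pow_freeOperator_single (A B : Matrix (Fin N) (Fin N) ℂ) (n : ℤ)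
    (v : EuclideanSpace ℂ (Fin N)) (k : ℕ) (m : ℤ) :
    ((freeOperator A B ^ k) (lp.single 2 n v : StateSpace N)) m =
      ((2 * Real.pi : ℂ)⁻¹) • ∫ p in -Real.pi..Real.pi,
        character (m - n) p • (symbolOp A B p ^ k) v := by
  have hcont : ∀ (d : ℤ) (k : ℕ), Continuous fun p => character d p • (symbolOp A B p ^ k) v :=
    fun d k => (continuous_character d).smul
      (((continuous_symbolOp A B).pow k).clm_apply continuous_const)
  induction k generalizing m with
  | zero =>
    simp only [pow_zero, one_apply_eq_self]
    rw [intervalIntegral.integral_smul_const, integral_character]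
    by_cases h : m = n
    · subst h
      rw [if_pos (sub_self m), smul_smul, inv_mul_cancel₀ (by simp [Real.pi_ne_zero]), one_smul]
      simp
    · rw [if_neg (sub_ne_zero.2 h), zero_smul, smul_zero]
      exact lp.single_apply_ne (E := fun _ : ℤ => EuclideanSpace ℂ (Fin N)) 2 n v h
  | succ k ih =>
    rw [pow_succ', mul_apply_eq_comp, freeOperator_apply, ih, ih, ih]
    simp only [map_smul]
    rw [← ContinuousLinearMap.intervalIntegral_comp_comm _ ((hcont _ k).intervalIntegrable _ _),
      ← ContinuousLinearMap.intervalIntegral_comp_comm _ ((hcont _ k).intervalIntegrable _ _),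
      ← ContinuousLinearMap.intervalIntegral_comp_comm _ ((hcont _ k).intervalIntegrable _ _),
      ← smul_add, ← smul_add, ← intervalIntegral.integral_add, ← intervalIntegral.integral_add]
    · congr 1
      refine intervalIntegral.integral_congr fun p _ => ?_
      have e1 : character (m - 1 - n) p = character (m - n) p * Complex.exp (Complex.I * p) := by
        rw [character, character, ← Complex.exp_add]
        push_cast
        ring_nf
      have e2 : character (m + 1 - n) p = character (m - n) p * Complex.exp (-(Complex.I * p)) := by
        rw [character, character, ← Complex.exp_add]
        push_cast
        ring_nf
      simp only [map_smul]
      rw [pow_succ', mul_apply_eq_comp, e1, e2]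
      generalize (symbolOp A B p ^ k) v = x
      rw [symbolOp_eq]
      simp only [add_apply, smul_apply, smul_add, smul_smul]
      abel
    · exact ((ContinuousLinearMap.continuous _).comp (hcont _ k)).add
        ((ContinuousLinearMap.continuous _).comp (hcont _ k)) |>.intervalIntegrable _ _
    · exact ((ContinuousLinearMap.continuous _).comp (hcont _ k)).intervalIntegrable _ _
    · exact ((ContinuousLinearMap.continuous _).comp (hcont _ k)).intervalIntegrable _ _
    · exact ((ContinuousLinearMap.continuous _).comp (hcont _ k)).intervalIntegrable _ _

variable {A B : Matrix (Fin N) (Fin N) ℂ} {lam : Fin N → ℝ → ℝ}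
  {W : Fin N → ℝ → EuclideanSpace ℂ (Fin N)}

/-- Expand v in the orthonormal basis `W j p`, on which h(p)^k is diagonal. -/
theorem IsAnalyticEigenbasis.inner_pow (h : IsAnalyticEigenbasis A B lam W) {p : ℝ}
    (hp : p ∈ Set.Icc (-Real.pi) Real.pi) (v : EuclideanSpace ℂ (Fin N)) (k : ℕ) :
    (⟪v, (symbolOp A B p ^ k) v⟫_ℂ).re = ∑ j, lam j p ^ k * ‖⟪W j p, v⟫_ℂ‖ ^ 2 := by
  have hspan : ⊤ ≤ Submodule.span ℂ (Set.range fun j => W j p) := by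
    rw [((h.orthonormal p hp).linearIndependent.span_eq_top_of_card_eq_finrank' (by simp))]
  let b := OrthonormalBasis.mk (h.orthonormal p hp) hspan
  have hb : ∀ j, b j = W j p := fun j => by simp [b]
  have hpow : ∀ j, (symbolOp A B p ^ k) (W j p) = ((lam j p ^ k : ℝ) : ℂ) • W j p := by
    intro j
    induction k with
    | zero => simp
    | succ k ih =>
      rw [pow_succ, mul_apply_eq_comp]
      have := h.eigen p hp j
      rw [← symbolOp] at this
      rw [this, map_smul, ih, smul_smul]
      push_cast
      ring_nf
  have hv : (symbolOp A B p ^ k) v = ∑ j, (⟪W j p, v⟫_ℂ * ((lam j p ^ k : ℝ) : ℂ)) • W j p := by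
    conv_lhs => rw [← b.sum_repr' v]
    rw [map_sum]
    refine Finset.sum_congr rfl fun j _ => ?_
    rw [map_smul, hb, hpow, smul_smul]
  rw [hv, inner_sum, Complex.re_sum]
  refine Finset.sum_congr rfl fun j _ => ?_
  rw [inner_smul_right, mul_comm (⟪W j p, v⟫_ℂ), mul_assoc, Complex.re_ofReal_mul,
    ← inner_conj_symm v (W j p), Complex.mul_conj, Complex.ofReal_re, Complex.normSq_eq_norm_sq]

theorem inner_pow_freeOperator_single (h : IsAnalyticEigenbasis A B lam W) (n : ℤ)
    (v : EuclideanSpace ℂ (Fin N)) (k : ℕ) :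
    (⟪(lp.single 2 n v : StateSpace N), (freeOperator A B ^ k) (lp.single 2 n v : StateSpace N)⟫_ℂ).re =
      ∫ p in Set.Icc (-Real.pi) Real.pi,
        ∑ j, lam j p ^ k * (‖⟪W j p, v⟫_ℂ‖ ^ 2 / (2 * Real.pi)) := by
  have hcont : Continuous fun p => (symbolOp A B p ^ k) v :=
    ((continuous_symbolOp A B).pow k).clm_apply continuous_const
  have hπ : -Real.pi ≤ Real.pi := by linarith [Real.pi_pos]
  rw [lp.inner_single_left, pow_freeOperator_single, sub_self, inner_smul_right]
  have h1 : ∀ p, character 0 p • (symbolOp A B p ^ k) v = (symbolOp A B p ^ k) v := fun p => by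
    simp [character]
  simp only [h1]
  have h2 : ⟪v, ∫ p in -Real.pi..Real.pi, (symbolOp A B p ^ k) v⟫_ℂ =
      ∫ p in -Real.pi..Real.pi, ⟪v, (symbolOp A B p ^ k) v⟫_ℂ :=
    ((innerSL ℂ v).intervalIntegral_comp_comm (hcont.intervalIntegrable _ _)).symm
  have hcont2 : Continuous fun p => ⟪v, (symbolOp A B p ^ k) v⟫_ℂ := continuous_const.inner hcont
  have h3 : (∫ p in -Real.pi..Real.pi, ⟪v, (symbolOp A B p ^ k) v⟫_ℂ).re =
      ∫ p in -Real.pi..Real.pi, (⟪v, (symbolOp A B p ^ k) v⟫_ℂ).re :=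
    (Complex.reCLM.intervalIntegral_comp_comm (hcont2.intervalIntegrable _ _)).symm
  have h4 : ((2 * Real.pi : ℂ)⁻¹) = (((2 * Real.pi)⁻¹ : ℝ) : ℂ) := by push_cast; rfl
  rw [h2, h4, Complex.re_ofReal_mul, h3, intervalIntegral.integral_of_le hπ,
    ← integral_Icc_eq_integral_Ioc, ← integral_const_mul]
  refine setIntegral_congr_fun measurableSet_Icc fun p hp => ?_
  rw [h.inner_pow hp, Finset.mul_sum]
  refine Finset.sum_congr rfl fun j _ => ?_
  rw [div_eq_mul_inv]
  ring

end Moments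

/-! ### The critical set -/

/-- Either λ' is not identically zero and has finitely many zeros, or λ is constant on the interval
and the critical set is one point. -/
theorem finite_branchCriticalSet {lam : ℝ → ℝ}
    (h : AnalyticOnNhd ℝ lam (Set.Icc (-Real.pi) Real.pi)) : (branchCriticalSet lam).Finite := by
  by_cases h0 : ∃ p ∈ Set.Icc (-Real.pi) Real.pi, deriv lam p ≠ 0
  · exact (finite_zeros h.deriv isPreconnected_Icc isCompact_Icc h0).image lam
  · push Not at h0
    refine (Set.finite_singleton (lam (-Real.pi))).subset ?_
    rintro _ ⟨p, ⟨hp, -⟩, rfl⟩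
    refine constant_of_has_deriv_right_zero h.continuousOn (fun x hx => ?_) p hp
    have hx' := Set.Ico_subset_Icc_self hx
    have := (h x hx').differentiableAt.hasDerivAt
    rw [h0 x hx'] at this
    exact this.hasDerivWithinAt

/-- The preimage of a null set under an analytic function is null away from critical points. -/
theorem volume_preimage_eq_zero {lam : ℝ → ℝ} {s t : Set ℝ} (h : AnalyticOnNhd ℝ lam s)
    (ht : volume t = 0) : volume {p | p ∈ s ∧ lam p ∈ t ∧ deriv lam p ≠ 0} = 0 := by
  -- Near a noncritical p the function has an analytic local inverse, and differentiable maps send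
  -- null sets to null sets.
  refine measure_null_of_locally_null _ fun p ⟨hp, _, hd⟩ => ?_
  have hstrict := (h p hp).hasStrictDerivAt
  let g := hstrict.localInverse _ _ _ hd
  have hg : AnalyticAt ℝ g (lam p) := (h p hp).analyticAt_localInverse hd
  have hleft : ∀ᶠ x in 𝓝 p, g (lam x) = x :=
    (hstrict.hasStrictFDerivAt_equiv hd).eventually_left_inverse
  have hdiff : ∀ᶠ x in 𝓝 p, DifferentiableAt ℝ g (lam x) :=
    (h p hp).continuousAt.eventually
      (hg.eventually_analyticAt.mono fun y hy => hy.differentiableAt)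
  refine ⟨{x | (g (lam x) = x ∧ DifferentiableAt ℝ g (lam x)) ∧ lam x ∈ t}, ?_, ?_⟩
  · rw [mem_nhdsWithin_iff_eventually]
    filter_upwards [hleft, hdiff] with x h1 h2 h3
    exact ⟨⟨h1, h2⟩, h3.2.1⟩
  · have hnull : volume (g '' {y | y ∈ t ∧ DifferentiableAt ℝ g y}) = 0 :=
      addHaar_image_eq_zero_of_differentiableOn_of_addHaar_eq_zero volume
        (fun y hy => hy.2.differentiableWithinAt) (measure_mono_null (fun y hy => hy.1) ht)
    refine measure_mono_null ?_ hnull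
    rintro x ⟨⟨h1, h2⟩, h3⟩
    exact ⟨lam x, ⟨h3, h2⟩, h1⟩

/-! ### The spectral measures of finitely supported vectors -/

section Bands

variable {N : ℕ} {A B : Matrix (Fin N) (Fin N) ℂ} {lam : Fin N → ℝ → ℝ}
  {W : Fin N → ℝ → EuclideanSpace ℂ (Fin N)}

/-- The density of the component of `v` along the `j`-th eigenvector. -/
noncomputable def weight (W : Fin N → ℝ → EuclideanSpace ℂ (Fin N)) (v : EuclideanSpace ℂ (Fin N))
    (j : Fin N) (p : ℝ) : ℝ := ‖⟪W j p, v⟫_ℂ‖ ^ 2 / (2 * Real.pi)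

/-- The contribution of the `j`-th band to the spectral measure of a vector supported at one
site. -/
noncomputable def bandMeasure (lam : Fin N → ℝ → ℝ) (W : Fin N → ℝ → EuclideanSpace ℂ (Fin N))
    (v : EuclideanSpace ℂ (Fin N)) (j : Fin N) : Measure ℝ :=
  ((volume.restrict (Set.Icc (-Real.pi) Real.pi)).withDensity
    fun p => ENNReal.ofReal (weight W v j p)).map (lam j)

theorem weight_nonneg (v : EuclideanSpace ℂ (Fin N)) (j : Fin N) (p : ℝ) : 0 ≤ weight W v j p := by
  unfold weight
  positivity

theorem IsAnalyticEigenbasis.continuousOn_weight (h : IsAnalyticEigenbasis A B lam W)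
    (v : EuclideanSpace ℂ (Fin N)) (j : Fin N) :
    ContinuousOn (weight W v j) (Set.Icc (-Real.pi) Real.pi) := by
  have h1 := (h.analytic_eigenvector j).continuousOn
  exact ((h1.inner continuousOn_const).norm.pow 2).div_const _

theorem IsAnalyticEigenbasis.aemeasurable_eigenvalue (h : IsAnalyticEigenbasis A B lam W)
    (v : EuclideanSpace ℂ (Fin N)) (j : Fin N) :
    AEMeasurable (lam j) ((volume.restrict (Set.Icc (-Real.pi) Real.pi)).withDensity
      fun p => ENNReal.ofReal (weight W v j p)) :=
  ((h.analytic_eigenvalue j).continuousOn.aemeasurable measurableSet_Icc).mono_ac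
    (withDensity_absolutelyContinuous _ _)

theorem IsAnalyticEigenbasis.isFiniteMeasure_bandMeasure (h : IsAnalyticEigenbasis A B lam W)
    (v : EuclideanSpace ℂ (Fin N)) (j : Fin N) : IsFiniteMeasure (bandMeasure lam W v j) := by
  have := isFiniteMeasure_withDensity_ofReal
    ((h.continuousOn_weight v j).integrableOn_compact (μ := volume) isCompact_Icc).2
  exact Measure.isFiniteMeasure_map _ _

theorem IsAnalyticEigenbasis.integral_bandMeasure (h : IsAnalyticEigenbasis A B lam W)
    (v : EuclideanSpace ℂ (Fin N)) (j : Fin N) {f : ℝ → ℝ} (hf : Continuous f) :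
    ∫ x, f x ∂(bandMeasure lam W v j) =
      ∫ p in Set.Icc (-Real.pi) Real.pi, f (lam j p) * weight W v j p := by
  rw [bandMeasure, integral_map (h.aemeasurable_eigenvalue v j) hf.aestronglyMeasurable,
    integral_withDensity_eq_integral_toReal_smul₀]
  · refine integral_congr_ae (Eventually.of_forall fun p => ?_)
    simp only [ENNReal.toReal_ofReal (weight_nonneg v j p), smul_eq_mul, mul_comm]
  · exact ((h.continuousOn_weight v j).aemeasurable measurableSet_Icc).ennreal_ofReal
  · exact Eventually.of_forall fun p => ENNReal.ofReal_lt_top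

/-- A measurable set whose preimage in the Brillouin zone is null is a null set for the band
measure. -/
theorem IsAnalyticEigenbasis.bandMeasure_eq_zero (h : IsAnalyticEigenbasis A B lam W)
    (v : EuclideanSpace ℂ (Fin N)) (j : Fin N) {s : Set ℝ} (hs : MeasurableSet s)
    (h0 : volume (lam j ⁻¹' s ∩ Set.Icc (-Real.pi) Real.pi) = 0) : bandMeasure lam W v j s = 0 := by
  rw [bandMeasure, Measure.map_apply_of_aemeasurable (h.aemeasurable_eigenvalue v j) hs]
  refine withDensity_absolutelyContinuous _ _ ?_
  rwa [Measure.restrict_apply' measurableSet_Icc]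

/-- The union of the bands. -/
def bands (lam : Fin N → ℝ → ℝ) : Set ℝ := ⋃ j, lam j '' Set.Icc (-Real.pi) Real.pi

theorem IsAnalyticEigenbasis.isCompact_bands (h : IsAnalyticEigenbasis A B lam W) :
    IsCompact (bands lam) :=
  isCompact_iUnion fun j => isCompact_Icc.image_of_continuousOn
    (h.analytic_eigenvalue j).continuousOn

theorem IsAnalyticEigenbasis.bandMeasure_compl_bands (h : IsAnalyticEigenbasis A B lam W)
    (v : EuclideanSpace ℂ (Fin N)) (j : Fin N) : bandMeasure lam W v j (bands lam)ᶜ = 0 := by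
  refine h.bandMeasure_eq_zero v j h.isCompact_bands.measurableSet.compl ?_
  have : lam j ⁻¹' (bands lam)ᶜ ∩ Set.Icc (-Real.pi) Real.pi = ∅ := by
    ext p
    simp only [Set.mem_inter_iff, Set.mem_preimage, Set.mem_compl_iff, Set.mem_empty_iff_false,
      iff_false, not_and]
    exact fun hp hp' => hp (Set.mem_iUnion.2 ⟨j, p, hp', rfl⟩)
  rw [this, measure_empty]

/-- Both measures have the same moments, and the band measures live on a bounded set. -/
theorem IsAnalyticEigenbasis.spectralMeasure_single (h : IsAnalyticEigenbasis A B lam W)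
    (hB : B.IsHermitian) (n : ℤ) (v : EuclideanSpace ℂ (Fin N)) :
    spectralMeasure (freeOperator A B) (lp.single 2 n v : StateSpace N) =
      ∑ j, bandMeasure lam W v j := by
  have hfin := h.isFiniteMeasure_bandMeasure v
  have : IsFiniteMeasure (∑ j, bandMeasure lam W v j) := ⟨by
    rw [Measure.finsetSum_apply]
    exact ENNReal.sum_lt_top.2 fun j _ => measure_lt_top _ _⟩
  obtain ⟨R, hR⟩ := h.isCompact_bands.isBounded.subset_closedBall 0
  have hbdd : ∀ j, ∀ᵐ x ∂(bandMeasure lam W v j), x ∈ Set.Icc (-R) R := fun j => by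
    refine measure_mono_null (fun x hx => ?_) (h.bandMeasure_compl_bands v j)
    intro hx'
    have := hR hx'
    rw [Real.closedBall_eq_Icc, zero_sub, zero_add] at this
    exact hx this
  refine spectralMeasure_eq_of_moments (isSelfAdjoint_freeOperator A B hB) _ _ (R := R) ?_
    fun k => ?_
  · rw [ae_iff, Measure.finsetSum_apply]
    exact Finset.sum_eq_zero fun j _ => hbdd j
  · rw [inner_pow_freeOperator_single h, integral_finsetSum_measure, integral_finsetSum]
    · exact Finset.sum_congr rfl fun j _ => h.integral_bandMeasure v j (continuous_pow k)
    · exact fun j _ => (((h.analytic_eigenvalue j).continuousOn.pow k).mul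
        (h.continuousOn_weight v j)).integrableOn_compact isCompact_Icc
    · intro j _
      refine Integrable.of_bound (by fun_prop) (R ^ k) ((hbdd j).mono fun x hx => ?_)
      rw [norm_pow, Real.norm_eq_abs]
      exact pow_le_pow_left₀ (abs_nonneg x) (abs_le.2 hx) k

/-- A set which is null for all band measures is null for all spectral measures. -/
theorem IsAnalyticEigenbasis.spectralMeasure_eq_zero (h : IsAnalyticEigenbasis A B lam W)
    (hB : B.IsHermitian) {s : Set ℝ} (hs : ∀ v j, bandMeasure lam W v j s = 0)
    (ψ : StateSpace N) : spectralMeasure (freeOperator A B) ψ s = 0 := by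
  have hmem : ∀ (n : ℤ) (v : EuclideanSpace ℂ (Fin N)),
      (lp.single 2 n v : StateSpace N) ∈ nullSubspace (freeOperator A B) s := by
    intro n v
    change spectralMeasure _ _ s = 0
    rw [h.spectralMeasure_single hB, Measure.finsetSum_apply]
    exact Finset.sum_eq_zero fun j _ => hs v j
  -- ψ is the limit of finitely supported vectors, which lie in the closed subspace `nullSubspace`.
  have hsum : HasSum (fun n : ℤ => (lp.single 2 n (ψ n) : StateSpace N)) ψ :=
    lp.hasSum_single ENNReal.ofNat_ne_top ψ
  exact (isClosed_nullSubspace (isSelfAdjoint_freeOperator A B hB) s).mem_of_tendsto hsum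
    (Eventually.of_forall fun t => Submodule.sum_mem _ fun n _ => hmem n _)

/-! ### The spectrum of the free operator -/

theorem IsAnalyticEigenbasis.finite_criticalSet (h : IsAnalyticEigenbasis A B lam W) :
    (criticalSet lam).Finite :=
  Set.finite_iUnion fun j => finite_branchCriticalSet (h.analytic_eigenvalue j)

/-- A parameter p whose value λ_j(p) avoids κ(H₀) is noncritical for λ_j, so preimages of Lebesgue
null sets are null. -/
theorem IsAnalyticEigenbasis.isPurelyAbsolutelyContinuousOn (h : IsAnalyticEigenbasis A B lam W)
    (hB : B.IsHermitian) :
    IsPurelyAbsolutelyContinuousOn (freeOperator A B) (criticalSet lam)ᶜ := by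
  intro ψ
  have hm : MeasurableSet (criticalSet lam)ᶜ := h.finite_criticalSet.measurableSet.compl
  refine Measure.AbsolutelyContinuous.mk fun t htm ht => ?_
  rw [Measure.restrict_apply htm]
  refine h.spectralMeasure_eq_zero hB (fun v j => ?_) ψ
  refine h.bandMeasure_eq_zero v j (htm.inter hm) ?_
  refine measure_mono_null ?_ (volume_preimage_eq_zero (h.analytic_eigenvalue j) ht)
  rintro p ⟨⟨h1, h2⟩, h3⟩
  exact ⟨h3, h1, fun h4 => h2 (Set.mem_iUnion.2 ⟨j, p, ⟨h3, h4⟩, rfl⟩)⟩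

theorem IsAnalyticEigenbasis.bands_subset_spectrum (h : IsAnalyticEigenbasis A B lam W)
    (hB : B.IsHermitian) {x : ℝ} (hx : x ∈ bands lam) :
    (x : ℂ) ∈ spectrum ℂ (freeOperator A B) := by
  obtain ⟨j, p, hp, rfl⟩ := Set.mem_iUnion.1 hx
  by_contra hxs
  obtain ⟨g, hgc, hg0, hg1, hg⟩ :=
    exists_integral_spectralMeasure_eq_zero (isSelfAdjoint_freeOperator A B hB) hxs
  -- For this vector the j-th weight at p is 1 / (2π). A continuous nonnegative integrand with zero
  -- integral vanishes everywhere on the interval, so g(λ_j(p)) = 1 gives a contradiction.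
  have h1 := hg (lp.single 2 0 (W j p) : StateSpace N)
  have hfin := h.isFiniteMeasure_bandMeasure (W j p)
  rw [h.spectralMeasure_single hB,
    integral_finsetSum_measure fun i _ => g.continuous.integrable_of_hasCompactSupport hgc,
    Finset.sum_eq_zero_iff_of_nonneg fun i _ => integral_nonneg hg0] at h1
  have h2 := h1 j (Finset.mem_univ j)
  rw [h.integral_bandMeasure _ _ g.continuous] at h2
  have hcont : ContinuousOn (fun q => g (lam j q) * weight W (W j p) j q)
      (Set.Icc (-Real.pi) Real.pi) :=
    (g.continuous.comp_continuousOn (h.analytic_eigenvalue j).continuousOn).mul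
      (h.continuousOn_weight _ j)
  rw [integral_eq_zero_iff_of_nonneg (fun q => mul_nonneg (hg0 _) (weight_nonneg _ _ _))
    (hcont.integrableOn_compact isCompact_Icc)] at h2
  have hπ : -Real.pi ≠ Real.pi := by linarith [Real.pi_pos]
  have h3 : g (lam j p) * weight W (W j p) j p = 0 :=
    Measure.eqOn_Icc_of_ae_eq volume hπ h2 hcont continuousOn_const hp
  rw [hg1, one_mul, weight, inner_self_eq_norm_sq_to_K, (h.orthonormal p hp).1 j] at h3
  simp [Real.pi_ne_zero] at h3

theorem IsAnalyticEigenbasis.spectrum_eq (h : IsAnalyticEigenbasis A B lam W)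
    (hB : B.IsHermitian) : spectrum ℂ (freeOperator A B) = Complex.ofReal '' bands lam := by
  refine (spectrum_subset_of_spectralMeasure_compl (isSelfAdjoint_freeOperator A B hB)
    h.isCompact_bands.isClosed fun ψ =>
      h.spectralMeasure_eq_zero hB h.bandMeasure_compl_bands ψ).antisymm ?_
  rintro _ ⟨x, hx, rfl⟩
  exact h.bands_subset_spectrum hB hx

/-- An eigenvector's spectral measure is a positive multiple of a point mass, which absolute
continuity excludes off κ(H₀). -/
theorem IsAnalyticEigenbasis.pointSpectrum_subset (h : IsAnalyticEigenbasis A B lam W)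
    (hB : B.IsHermitian) :
    pointSpectrum (freeOperator A B) ⊆ Complex.ofReal '' criticalSet lam := by
  have hT := isSelfAdjoint_freeOperator A B hB
  intro z hz
  have hreal : (starRingEnd ℂ) z = z :=
    (ContinuousLinearMap.isSelfAdjoint_iff_isSymmetric.1 hT).conj_eigenvalue_eq_self hz
  obtain ⟨x, rfl⟩ := Complex.conj_eq_iff_real.1 hreal
  refine ⟨x, ?_, rfl⟩
  by_contra hx
  obtain ⟨ψ, hψ⟩ := Module.End.HasEigenvalue.exists_hasEigenvector hz
  have h1 : freeOperator A B ψ = (x : ℂ) • ψ := hψ.apply_eq_smul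
  have h2 : (spectralMeasure (freeOperator A B) ψ).restrict (criticalSet lam)ᶜ {x} = 0 :=
    h.isPurelyAbsolutelyContinuousOn hB ψ (Real.volume_singleton)
  rw [Measure.restrict_apply (measurableSet_singleton x),
    Set.inter_eq_left.2 (Set.singleton_subset_iff.2 hx), spectralMeasure_of_eigenvector hT h1,
    Measure.smul_apply, Measure.dirac_apply_of_mem (Set.mem_singleton x), smul_eq_mul, mul_one,
    ENNReal.ofReal_eq_zero] at h2
  have h3 : ‖ψ‖ = 0 := by nlinarith [norm_nonneg ψ]
  exact hψ.2 (norm_eq_zero.1 h3)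

/-- Without atoms the finite set κ(H₀) has no mass, so the spectral measure is both absolutely
continuous and singular, hence zero. -/
theorem IsAnalyticEigenbasis.eq_zero_of_mem_singularContinuousSubspace
    (h : IsAnalyticEigenbasis A B lam W) (hB : B.IsHermitian) {ψ : StateSpace N}
    (hψ : ψ ∈ singularContinuousSubspace (freeOperator A B)) : ψ = 0 := by
  have hT := isSelfAdjoint_freeOperator A B hB
  obtain ⟨hatom, hsing⟩ : IsSingularContinuous (spectralMeasure (freeOperator A B) ψ) := hψ
  refine eq_zero_of_spectralMeasure_eq_zero hT ?_
  have hm : MeasurableSet (criticalSet lam) := h.finite_criticalSet.measurableSet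
  have hcrit : spectralMeasure (freeOperator A B) ψ (criticalSet lam) = 0 := by
    rw [← Set.biUnion_of_singleton (criticalSet lam)]
    exact (measure_biUnion_null_iff h.finite_criticalSet.countable).2 fun x _ => hatom x
  have hac : spectralMeasure (freeOperator A B) ψ ≪ volume := by
    rw [← Measure.restrict_compl_add_restrict (μ := spectralMeasure (freeOperator A B) ψ) hm,
      Measure.restrict_eq_zero.2 hcrit, add_zero]
    exact h.isPurelyAbsolutelyContinuousOn hB ψ
  exact Measure.eq_zero_of_absolutelyContinuous_of_mutuallySingular hac hsing

theorem IsAnalyticEigenbasis.singularContinuousSpectrum_eq_empty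
    (h : IsAnalyticEigenbasis A B lam W) (hB : B.IsHermitian) :
    singularContinuousSpectrum (freeOperator A B) (isSelfAdjoint_freeOperator A B hB) = ∅ := by
  have : Subsingleton (singularContinuousSubspace (freeOperator A B)) :=
    ⟨fun φ ψ => Subtype.ext ((h.eq_zero_of_mem_singularContinuousSubspace hB φ.2).trans
      (h.eq_zero_of_mem_singularContinuousSubspace hB ψ.2).symm)⟩
  have : Subsingleton (singularContinuousSubspace (freeOperator A B) →L[ℂ]
      singularContinuousSubspace (freeOperator A B)) :=
    ⟨fun S T => ContinuousLinearMap.ext fun ψ => Subsingleton.elim _ _⟩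
  exact spectrum.of_subsingleton _

end Bands

end BlockJacobi

theorem proposition1 (N : ℕ) (A B : Matrix (Fin N) (Fin N) ℂ) (hB : B.IsHermitian) :
    (∃ (lam : Fin N → ℝ → ℝ) (W : Fin N → ℝ → EuclideanSpace ℂ (Fin N)),
      BlockJacobi.IsAnalyticEigenbasis A B lam W) ∧
    ∀ (lam : Fin N → ℝ → ℝ) (W : Fin N → ℝ → EuclideanSpace ℂ (Fin N)),
      BlockJacobi.IsAnalyticEigenbasis A B lam W →
        (BlockJacobi.criticalSet lam).Finite ∧
        BlockJacobi.IsPurelyAbsolutelyContinuousOn (BlockJacobi.freeOperator A B)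
          (BlockJacobi.criticalSet lam)ᶜ ∧
        spectrum ℂ (BlockJacobi.freeOperator A B) =
          Complex.ofReal '' (⋃ j, lam j '' Set.Icc (-Real.pi) Real.pi) ∧
        BlockJacobi.pointSpectrum (BlockJacobi.freeOperator A B) ⊆
          Complex.ofReal '' BlockJacobi.criticalSet lam ∧
        BlockJacobi.singularContinuousSpectrum (BlockJacobi.freeOperator A B)
          (BlockJacobi.isSelfAdjoint_freeOperator A B hB) = ∅ :=
  ⟨BlockJacobi.exists_isAnalyticEigenbasis A B hB, fun _ _ h =>
    ⟨h.finite_criticalSet, h.isPurelyAbsolutelyContinuousOn hB, h.spectrum_eq hB,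
      h.pointSpectrum_subset hB, h.singularContinuousSpectrum_eq_empty hB⟩⟩
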